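/- Consider a single-server $G/G/1$ queue, started at time $0$ with an arrival to an empty system, with i.i.d. nonnegative interarrival times distributed as $U$ and, independent of them, i.i.d. nonnegative service times distributed as $S$, where $\mathbb{E}U^3,\mathbb{E}S^3<\infty$. Let $\lambda=1/\mathbb{E}U$ and $\rho=\lambda\,\mathbb{E}S<1$. Let $V(t)$ be the workload at time $t$, and let $X$ have the limiting (steady-state) distribution of $X(t)=(1-\rho)V(t)$ as $t\to\infty$. Let $Y$ be exponentially distributed with rate $2/(\lambda\,\mathbb{E}(U-S)^2)$, where $U$ and $S$ are independent. Suppose that $U$ has a density $g$ and let $\eta(x)=g(x)/\mathbb{P}(U>x)$, $x\ge 0$, be its hazard rate, $\overline\eta=\sup_{x\ge0}\eta(x)$ and $\underline\eta=\inf_{x\ge0}\eta(x)$. Let $\mathcal M_3$ be the set of $h:\mathbb{R}\to\mathbb{R}$ whose derivatives of orders $1,2,3$ exist and are bounded by $1$ in absolute value. (a) If $\eta$ is nonincreasing on $[0,\infty)$ and $\overline\eta=\eta(0)<\infty$, then $\mathbb{E}X<\infty$ and $$|\mathbb{E}X-\mathbb{E}Y|\le(1-\rho)\,\overline C_3,$$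 and, if also $\mathbb{E}S^4<\infty$, $$\sup_{h\in\mathcal M_3}|\mathbb{E}h(X)-\mathbb{E}h(Y)|\le(1-\rho)\,\overline C_3'+(1-\rho)^2\,\overline C_4'.$$ Here $\overline C_3,\overline C_3'$ are functions of $\overline\eta$ and the first three moments of $U$ and $S$ only, and $\overline C_4'$ is a function of $\overline\eta$, the first three moments of $U$ and the first four moments of $S$ only. (b) If $\overline\eta<\infty$ and $\underline\eta>0$, then the same bounds hold with constants $\underline C_3,\underline C_3',\underline C_4'$, where $\underline C_3,\underline C_3'$ are functions of $\overline\eta,\underline\eta$ and the first three moments of $U$ and $S$ only, and $\underline C_4'$ is a function of $\overline\eta,\underline\eta$, the first three moments of $U$ and the first four moments of $S$ only. In both cases the constants are continuous functions of these arguments on the set where all arguments are positive; in particular they stay bounded as $\rho\uparrow1$ while the arguments converge to positive limits. -/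

import Mathlib

open MeasureTheory ProbabilityTheory Filter Topology

namespace GG1

/-- The primitives of a `G/G/1` queue that starts at time `0` with an arrival to an empty system:
customer `n` brings the work `S n`, and `U n` is the time between the arrivals of the customers
`n` and `n + 1`. All these variables are independent, the `U n` have a common law, the `S n` have
a common law, they are nonnegative and have finite third moments. -/
structure IsQueue {Ω : Type*} [MeasurableSpace Ω] (P : Measure Ω) (U S : ℕ → Ω → ℝ) : Prop where
  measurable_U : ∀ n, Measurable (U n)
  measurable_S : ∀ n, Measurable (S n)
  indep : iIndepFun (Sum.elim U S) P
  ident_U : ∀ n, IdentDistrib (U n) (U 0) P P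
  ident_S : ∀ n, IdentDistrib (S n) (S 0) P P
  nonneg_U : ∀ n, ∀ᵐ ω ∂P, 0 ≤ U n ω
  nonneg_S : ∀ n, ∀ᵐ ω ∂P, 0 ≤ S n ω
  integrable_U : Integrable (fun ω => U 0 ω ^ 3) P
  integrable_S : Integrable (fun ω => S 0 ω ^ 3) P

section Workload

variable {Ω : Type*} (U S : ℕ → Ω → ℝ)

/-- The arrival time of customer `n`; customer `0` arrives at time `0`. -/
def arrivalTime (n : ℕ) (ω : Ω) : ℝ := ∑ i ∈ Finset.range n, U i ω

/-- The work in the system immediately after the arrival of customer `n`; the server works at unit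
rate between arrivals. -/
def workAfterArrival (ω : Ω) : ℕ → ℝ
  | 0 => S 0 ω
  | n + 1 => max (workAfterArrival ω n - U n ω) 0 + S (n + 1) ω

/-- The last customer that arrived up to time `t`. -/
noncomputable def lastArrival (t : ℝ) (ω : Ω) : ℕ := sSup {n : ℕ | arrivalTime U n ω ≤ t}

/-- The workload `V(t)` in the system at time `t ≥ 0`. -/
noncomputable def workload (t : ℝ) (ω : Ω) : ℝ :=
  max (workAfterArrival U S ω (lastArrival U t ω)
    - (t - arrivalTime U (lastArrival U t ω) ω)) 0

variable [MeasurableSpace Ω] (P : Measure Ω)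

/-- The arrival rate `λ = 1 / E U`. -/
noncomputable def arrivalRate : ℝ := 1 / ∫ ω, U 0 ω ∂P

/-- The utilization `ρ = λ E S`. -/
noncomputable def utilization : ℝ := arrivalRate U P * ∫ ω, S 0 ω ∂P

/-- The scaled workload `X(t) = (1 - ρ) V(t)`. -/
noncomputable def scaledWorkload (t : ℝ) (ω : Ω) : ℝ :=
  (1 - utilization U S P) * workload U S t ω

/-- The rate `2 / (λ E (U - S)²)` of the approximating exponential distribution. -/
noncomputable def expRate : ℝ :=
  2 / (arrivalRate U P * ∫ ω, (U 0 ω - S 0 ω) ^ 2 ∂P)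

end Workload

/-- `g` is a density of the law of the real random variable `T`. -/
structure IsDensity {Ω : Type*} [MeasurableSpace Ω] (P : Measure Ω) (T : Ω → ℝ) (g : ℝ → ℝ) :
    Prop where
  measurable : Measurable g
  nonneg : ∀ x, 0 ≤ g x
  map_eq : P.map T = volume.withDensity (fun x => ENNReal.ofReal (g x))

section Hazard

variable {Ω : Type*} [MeasurableSpace Ω] (P : Measure Ω) (T : Ω → ℝ) (g : ℝ → ℝ)

/-- The hazard rate `η(x) = g(x) / (1 - G(x))` with `G(x) = P(T ≤ x)`. -/
noncomputable def hazardRate (x : ℝ) : ℝ := g x / (1 - P.real {ω | T ω ≤ x})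

/-- The supremum of the hazard rate over `[0, ∞)`. -/
noncomputable def hazardSup : ℝ := sSup (hazardRate P T g '' Set.Ici 0)

/-- The infimum of the hazard rate over `[0, ∞)`. -/
noncomputable def hazardInf : ℝ := sInf (hazardRate P T g '' Set.Ici 0)

end Hazard

/-- The first `k` moments `E T, …, E T ^ k` of `T`. -/
noncomputable def moments {Ω : Type*} [MeasurableSpace Ω] (P : Measure Ω) (T : Ω → ℝ) (k : ℕ) :
    Fin k → ℝ := fun i => moment T (i.val + 1) P

/-- The class `M_k` of functions whose derivatives of the orders `1, …, k` exist and are bounded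
by `1` in absolute value. -/
def smoothClass (k : ℕ) : Set (ℝ → ℝ) :=
  {h | (∀ j < k, Differentiable ℝ (iteratedDeriv j h)) ∧
    ∀ j, 1 ≤ j → j ≤ k → ∀ x, |iteratedDeriv j h x| ≤ 1}

/-- The standing assumptions: a `G/G/1` queue with utilization below `1`, whose interarrival time
has the density `g` with a hazard rate that is bounded above, and a random variable `X` that has
the limiting distribution of the scaled workload as time tends to infinity. -/
structure Setting {Ω Ω' : Type*} [MeasurableSpace Ω] [MeasurableSpace Ω']
    (P : Measure Ω) [IsProbabilityMeasure P] (P' : Measure Ω') [IsProbabilityMeasure P']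
    (U S : ℕ → Ω → ℝ) (g : ℝ → ℝ) (X : Ω' → ℝ) : Prop where
  isQueue : IsQueue P U S
  utilization_lt_one : utilization U S P < 1
  isDensity : IsDensity P (U 0) g
  bddAbove_hazardRate : BddAbove (hazardRate P (U 0) g '' Set.Ici 0)
  limit_law : TendstoInDistribution (scaledWorkload U S P) atTop X (fun _ : ℝ => P) P'

end GG1

/-!
The waiting times `W n` form the Lindley chain `W (n + 1) = (W n + S n - U n)⁺`, driven by
increments with mean `-a δ`, where `a = E U` and `δ = 1 - ρ`. For a function `h` let `γ` solve
Stein's equation `c γ' - γ = h - E h(Y)` of the exponential variable `Y`, where `c = E Y` satisfies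
`2 a c = E (U - S)²`, and put `f = c γ' - γ`. Let `Γ` be the primitive of `v ↦ γ (δ v)`.

Telescoping `E Γ (W n)` and expanding to third order, the first two terms of the expansion combine
to `a δ E f (δ W k)`, because of the choice of `c`. What remains are a Taylor remainder of order
`δ²` and `δ` times the squared idle times, whose second moments have a sum of at most a constant
times the sum of their first moments: short waiting times lead to idling with a probability that is
bounded below in terms of `P(U > 2 E S + 3)`, and `P(U > 2 E S + 3) ≥ exp (-η (2 E S + 3))` if `η`
bounds the hazard rate. The first moments are of order `δ` on average.

The integral of `f (δ V(t))` between two arrivals is the decrease of a primitive along the work that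
is served plus `f 0` times the idle time. Summing over the customers thus expresses the time average
of `f (δ V(t))` by the averages of `f (δ W k)` and by the idle times, up to `O(δ)`; in the limit it
becomes `E f (X) = E h(X) - E h(Y)`. Finally the boundedness of `h` is removed by replacing `h` by
`N arctan (h / N)` and letting `N → ∞`.
-/

namespace GG1

/-! ### The Lindley chain -/

section Lindley

variable {Ω : Type*} {U S : ℕ → Ω → ℝ}

/-- The waiting time of customer `n`: the work found in the system on arrival. -/
def waitingTime (U S : ℕ → Ω → ℝ) (n : ℕ) (ω : Ω) : ℝ := workAfterArrival U S ω n - S n ω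

/-- The idle time of the server between the arrivals of the customers `n` and `n + 1`. -/
noncomputable def idleTime (U S : ℕ → Ω → ℝ) (n : ℕ) (ω : Ω) : ℝ :=
  max (U n ω - S n ω - waitingTime U S n ω) 0

lemma workAfterArrival_eq (n : ℕ) (ω : Ω) :
    workAfterArrival U S ω n = waitingTime U S n ω + S n ω := by
  simp [waitingTime]

@[simp] lemma waitingTime_zero (ω : Ω) : waitingTime U S 0 ω = 0 := by
  simp [waitingTime, workAfterArrival]

lemma waitingTime_succ (n : ℕ) (ω : Ω) :
    waitingTime U S (n + 1) ω = max (waitingTime U S n ω + (S n ω - U n ω)) 0 := by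
  simp [waitingTime, workAfterArrival]

lemma waitingTime_succ_eq_add_idleTime (n : ℕ) (ω : Ω) :
    waitingTime U S (n + 1) ω
      = waitingTime U S n ω + (S n ω - U n ω) + idleTime U S n ω := by
  rw [waitingTime_succ, idleTime]
  grind

lemma waitingTime_nonneg (n : ℕ) (ω : Ω) : 0 ≤ waitingTime U S n ω := by
  cases n with
  | zero => simp
  | succ n => rw [waitingTime_succ]; exact le_max_right _ _

lemma idleTime_nonneg (n : ℕ) (ω : Ω) : 0 ≤ idleTime U S n ω := le_max_right _ _

/-- The `σ`-algebra generated by the primitives `U n`, `S n` of the customers `n ∈ A`. -/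
@[reducible]
def customerSigma (U S : ℕ → Ω → ℝ) (A : Set ℕ) : MeasurableSpace Ω :=
  ⨆ i ∈ {i : ℕ ⊕ ℕ | i.elim id id ∈ A}, MeasurableSpace.comap (Sum.elim U S i) inferInstance

lemma customerSigma_mono {A B : Set ℕ} (hAB : A ⊆ B) : customerSigma U S A ≤ customerSigma U S B :=
  biSup_mono fun _ hi => hAB hi

lemma measurable_elim_customerSigma {A : Set ℕ} (i : ℕ ⊕ ℕ) (hi : i.elim id id ∈ A) :
    Measurable[customerSigma U S A] (Sum.elim U S i) :=
  (comap_measurable _).mono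
    (le_iSup₂_of_le (f := fun j (_ : j ∈ {i : ℕ ⊕ ℕ | i.elim id id ∈ A}) =>
      MeasurableSpace.comap (Sum.elim U S j) inferInstance) i hi le_rfl) le_rfl

lemma measurable_U_customerSigma {A : Set ℕ} {n : ℕ} (hn : n ∈ A) :
    Measurable[customerSigma U S A] (U n) := measurable_elim_customerSigma (Sum.inl n) hn

lemma measurable_S_customerSigma {A : Set ℕ} {n : ℕ} (hn : n ∈ A) :
    Measurable[customerSigma U S A] (S n) := measurable_elim_customerSigma (Sum.inr n) hn

lemma measurable_waitingTime_customerSigma (n : ℕ) :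
    Measurable[customerSigma U S (Set.Iio n)] (waitingTime U S n) := by
  induction n with
  | zero =>
    rw [show waitingTime U S 0 = fun _ => 0 from funext waitingTime_zero]
    exact measurable_const
  | succ n ih =>
    rw [show waitingTime U S (n + 1) = fun ω => max (waitingTime U S n ω + (S n ω - U n ω)) 0 from
      funext (waitingTime_succ n)]
    have hW := ih.mono (customerSigma_mono (Set.Iio_subset_Iio n.le_succ)) le_rfl
    have hU : Measurable[customerSigma U S (Set.Iio (n + 1))] (U n) :=
      measurable_U_customerSigma n.lt_succ_self
    have hS : Measurable[customerSigma U S (Set.Iio (n + 1))] (S n) :=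
      measurable_S_customerSigma n.lt_succ_self
    exact (hW.add (hS.sub hU)).max measurable_const

end Lindley

lemma monotone_measureReal_le {Ω : Type*} [MeasurableSpace Ω] {P : Measure Ω} [IsFiniteMeasure P]
    (W : Ω → ℝ) : Monotone fun x => P.real {ω | W ω ≤ x} :=
  fun _ _ hxy => measureReal_mono fun _ hω => le_trans hω hxy

lemma integral_mul_indicator_le_of_indepFun {Ω β : Type*} [MeasurableSpace Ω] [MeasurableSpace β]
    {P : Measure Ω} [IsProbabilityMeasure P] {W : Ω → ℝ} {Y : Ω → β} (hW : Measurable W)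
    (hY : Measurable Y) (hWY : IndepFun W Y P) {F G : β → ℝ} (hF : Measurable F)
    (hG : Measurable G) (hFi : Integrable (fun ω => F (Y ω)) P) :
    ∫ ω, F (Y ω) * {ω | W ω ≤ G (Y ω)}.indicator 1 ω ∂P
      = ∫ ω, F (Y ω) * P.real {ω' | W ω' ≤ G (Y ω)} ∂P := by
  have := Measure.isProbabilityMeasure_map (μ := P) hW.aemeasurable
  have := Measure.isProbabilityMeasure_map (μ := P) hY.aemeasurable
  set f : ℝ × β → ℝ := fun p => F p.2 * {p : ℝ × β | p.1 ≤ G p.2}.indicator 1 p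
  have hf : Measurable f := (hF.comp measurable_snd).mul
    (measurable_one.indicator (measurableSet_le measurable_fst (hG.comp measurable_snd)))
  have hlaw : P.map (fun ω => (W ω, Y ω)) = (P.map W).prod (P.map Y) :=
    (indepFun_iff_map_prod_eq_prod_map_map hW.aemeasurable hY.aemeasurable).1 hWY
  have hfi : Integrable f ((P.map W).prod (P.map Y)) := by
    rw [← hlaw, integrable_map_measure hf.aestronglyMeasurable (hW.prodMk hY).aemeasurable]
    refine hFi.mono (hf.comp (hW.prodMk hY)).aestronglyMeasurable (Eventually.of_forall fun ω => ?_)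
    simp only [f, Function.comp_apply, norm_mul]
    refine mul_le_of_le_one_right (norm_nonneg _) ?_
    by_cases hω : W ω ≤ G (Y ω) <;> simp [Set.indicator, hω]
  have hsection (y : β) : ∫ x, f (x, y) ∂P.map W = F y * P.real {ω | W ω ≤ G y} := by
    have : (fun x => {p : ℝ × β | p.1 ≤ G p.2}.indicator (1 : ℝ × β → ℝ) (x, y))
        = (Set.Iic (G y)).indicator 1 := by
      ext x; simp [Set.indicator]
    simp only [f]
    rw [integral_const_mul, this, integral_indicator_one measurableSet_Iic,
      map_measureReal_apply hW measurableSet_Iic]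
    rfl
  calc ∫ ω, F (Y ω) * {ω | W ω ≤ G (Y ω)}.indicator 1 ω ∂P
      = ∫ p, f p ∂P.map fun ω => (W ω, Y ω) :=
        (integral_map (hW.prodMk hY).aemeasurable hf.aestronglyMeasurable).symm
    _ = ∫ y, ∫ x, f (x, y) ∂P.map W ∂P.map Y := by rw [hlaw, integral_prod_symm _ hfi]
    _ = ∫ ω, ∫ x, f (x, Y ω) ∂P.map W ∂P :=
        integral_map hY.aemeasurable hfi.swap.integral_prod_left.aestronglyMeasurable
    _ = ∫ ω, F (Y ω) * P.real {ω' | W ω' ≤ G (Y ω)} ∂P := by simp_rw [hsection]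

namespace IsQueue

variable {Ω : Type*} [MeasurableSpace Ω] {P : Measure Ω} {U S : ℕ → Ω → ℝ}

lemma comap_elim_le (h : IsQueue P U S) (i : ℕ ⊕ ℕ) :
    MeasurableSpace.comap (Sum.elim U S i) inferInstance ≤ ‹MeasurableSpace Ω› := by
  cases i with
  | inl n => exact (h.measurable_U n).comap_le
  | inr n => exact (h.measurable_S n).comap_le

lemma indep_customerSigma (h : IsQueue P U S) {A B : Set ℕ} (hAB : Disjoint A B) :
    Indep (customerSigma U S A) (customerSigma U S B) P :=
  indep_iSup_of_disjoint h.comap_elim_le h.indep (hAB.preimage _)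

lemma measurable_waitingTime (h : IsQueue P U S) (n : ℕ) : Measurable (waitingTime U S n) :=
  (measurable_waitingTime_customerSigma n).mono (iSup₂_le fun i _ => h.comap_elim_le i) le_rfl

lemma measurable_idleTime (h : IsQueue P U S) (n : ℕ) : Measurable (idleTime U S n) :=
  (((h.measurable_U n).sub (h.measurable_S n)).sub
    (h.measurable_waitingTime n)).max measurable_const

lemma measurable_pair (h : IsQueue P U S) (n : ℕ) : Measurable fun ω => (U n ω, S n ω) :=
  (h.measurable_U n).prodMk (h.measurable_S n)

lemma nonneg_pair (h : IsQueue P U S) (n : ℕ) : ∀ᵐ ω ∂P, 0 ≤ U n ω ∧ 0 ≤ S n ω :=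
  (h.nonneg_U n).and (h.nonneg_S n)

lemma indepFun_U_S (h : IsQueue P U S) (n : ℕ) : IndepFun (U n) (S n) P :=
  h.indep.indepFun (i := Sum.inl n) (j := Sum.inr n) Sum.inl_ne_inr

lemma indepFun_waitingTime (h : IsQueue P U S) (n : ℕ) :
    IndepFun (waitingTime U S n) (fun ω => (U n ω, S n ω)) P := by
  have hdisj : Disjoint (Set.Iio n) {n} := Set.disjoint_singleton_right.2 (lt_irrefl n)
  have hU : Measurable[customerSigma U S {n}] (U n) := measurable_U_customerSigma rfl
  have hS : Measurable[customerSigma U S {n}] (S n) := measurable_S_customerSigma rfl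
  rw [IndepFun_iff_Indep]
  exact indep_of_indep_of_le_left
    (indep_of_indep_of_le_right (h.indep_customerSigma hdisj)
      (Measurable.comap_le (hU.prodMk hS)))
    (measurable_waitingTime_customerSigma n).comap_le

variable [IsProbabilityMeasure P]

lemma identDistrib_pair (h : IsQueue P U S) (n : ℕ) :
    IdentDistrib (fun ω => (U n ω, S n ω)) (fun ω => (U 0 ω, S 0 ω)) P P :=
  (h.ident_U n).prodMk (h.ident_S n) (h.indepFun_U_S n) (h.indepFun_U_S 0)

lemma integrable_pair (h : IsQueue P U S) (n : ℕ) {ψ : ℝ × ℝ → ℝ} (hψ : Measurable ψ)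
    (hi : Integrable (fun ω => ψ (U 0 ω, S 0 ω)) P) :
    Integrable (fun ω => ψ (U n ω, S n ω)) P :=
  ((h.identDistrib_pair n).comp hψ).integrable_iff.2 hi

lemma integral_pair (h : IsQueue P U S) (n : ℕ) {ψ : ℝ × ℝ → ℝ} (hψ : Measurable ψ) :
    ∫ ω, ψ (U n ω, S n ω) ∂P = ∫ ω, ψ (U 0 ω, S 0 ω) ∂P :=
  ((h.identDistrib_pair n).comp hψ).integral_eq

lemma integral_waitingTime_mul (h : IsQueue P U S) (n : ℕ) {φ : ℝ → ℝ} {ψ : ℝ × ℝ → ℝ}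
    (hφ : Measurable φ) (hψ : Measurable ψ) :
    ∫ ω, φ (waitingTime U S n ω) * ψ (U n ω, S n ω) ∂P
      = (∫ ω, φ (waitingTime U S n ω) ∂P) * ∫ ω, ψ (U 0 ω, S 0 ω) ∂P := by
  rw [(h.indepFun_waitingTime n).integral_fun_comp_mul_comp
    (h.measurable_waitingTime n).aemeasurable (h.measurable_pair n).aemeasurable
    hφ.aestronglyMeasurable hψ.aestronglyMeasurable, h.integral_pair n hψ]

lemma integrable_waitingTime_mul (h : IsQueue P U S) (n : ℕ) {φ : ℝ → ℝ} {ψ : ℝ × ℝ → ℝ}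
    (hφ : Measurable φ) (hψ : Measurable ψ)
    (hφi : Integrable (fun ω => φ (waitingTime U S n ω)) P)
    (hψi : Integrable (fun ω => ψ (U 0 ω, S 0 ω)) P) :
    Integrable (fun ω => φ (waitingTime U S n ω) * ψ (U n ω, S n ω)) P :=
  ((h.indepFun_waitingTime n).comp hφ hψ).integrable_mul hφi (h.integrable_pair n hψ hψi)

lemma integral_mul_indicator_waitingTime_le (h : IsQueue P U S) (n : ℕ) {F G : ℝ × ℝ → ℝ}
    (hF : Measurable F) (hG : Measurable G) (hFi : Integrable (fun ω => F (U 0 ω, S 0 ω)) P) :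
    ∫ ω, F (U n ω, S n ω) * {ω | waitingTime U S n ω ≤ G (U n ω, S n ω)}.indicator 1 ω ∂P
      = ∫ ω, F (U 0 ω, S 0 ω) * P.real {ω' | waitingTime U S n ω' ≤ G (U 0 ω, S 0 ω)} ∂P := by
  rw [integral_mul_indicator_le_of_indepFun (h.measurable_waitingTime n) (h.measurable_pair n)
    (h.indepFun_waitingTime n) hF hG (h.integrable_pair n hF hFi)]
  exact h.integral_pair n (hF.mul ((monotone_measureReal_le _).measurable.comp hG))

end IsQueue

/-! ### Survival functions and hazard rates -/

section Survival

lemma measure_setOf_measure_Ioi_eq_zero {α : Type*} [LinearOrder α] [TopologicalSpace α]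
    [OrderTopology α] [SecondCountableTopology α] [MeasurableSpace α] (ν : Measure α)
    [NullSingletonClass ν] : ν {x | ν (Set.Ioi x) = 0} = 0 := by
  set Z : Set α := {x | ν (Set.Ioi x) = 0}
  obtain ⟨D, hDZ, hD, hDU⟩ : ∃ D ⊆ Z, D.Countable ∧ ⋃ x ∈ D, Set.Ioi x = ⋃ x ∈ Z, Set.Ioi x :=
    TopologicalSpace.isOpen_biUnion_countable Z Set.Ioi fun _ _ => isOpen_Ioi
  have hnull : ν (⋃ x ∈ Z, Set.Ioi x) = 0 := by
    rw [← hDU, measure_biUnion_null_iff hD]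
    exact fun x hx => hDZ hx
  have hrest : (Z \ ⋃ x ∈ Z, Set.Ioi x).Subsingleton := by
    intro x hx y hy
    simp only [Set.mem_sdiff, Set.mem_iUnion, Set.mem_Ioi, not_exists, not_lt] at hx hy
    exact le_antisymm (hx.2 y hy.1) (hy.2 x hx.1)
  refine measure_mono_null (t := (⋃ x ∈ Z, Set.Ioi x) ∪ (Z \ ⋃ x ∈ Z, Set.Ioi x)) ?_
    (measure_union_null hnull (hrest.measure_zero ν))
  rw [Set.union_sdiff_self]
  exact Set.subset_union_right

lemma exp_neg_mul_le_of_one_sub_mul_le {G : ℝ → ℝ} {η : ℝ} (h0 : G 0 = 1)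
    (hG : ∀ x d, 0 ≤ x → 0 ≤ d → (1 - η * d) * G x ≤ G (x + d)) {x : ℝ} (hx : 0 ≤ x) :
    Real.exp (-(η * x)) ≤ G x := by
  refine le_of_tendsto (Real.tendsto_one_add_div_pow_exp (-(η * x))) ?_
  obtain ⟨N, hN⟩ := exists_nat_ge (η * x)
  filter_upwards [eventually_ge_atTop (max N 1)] with n hn
  have hn1 : (1 : ℝ) ≤ n := by exact_mod_cast (le_max_right N 1).trans hn
  have hnN : η * x ≤ n := hN.trans (by exact_mod_cast (le_max_left N 1).trans hn)
  have hfactor : 1 + -(η * x) / n = 1 - η * (x / n) := by ring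
  have hfactor_nonneg : 0 ≤ 1 - η * (x / n) := by
    rw [sub_nonneg, ← mul_div_assoc]
    exact div_le_one_of_le₀ hnN (by linarith)
  have hpow (k : ℕ) : (1 - η * (x / n)) ^ k ≤ G (k * (x / n)) := by
    induction k with
    | zero => simp [h0]
    | succ k ih =>
      calc (1 - η * (x / n)) ^ (k + 1) = (1 - η * (x / n)) * (1 - η * (x / n)) ^ k := pow_succ' _ _
        _ ≤ (1 - η * (x / n)) * G (k * (x / n)) := mul_le_mul_of_nonneg_left ih hfactor_nonneg
        _ ≤ G (k * (x / n) + x / n) := hG _ _ (by positivity) (by positivity)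
        _ = G ((k + 1 : ℕ) * (x / n)) := by push_cast; ring_nf
  simpa [hfactor, mul_div_cancel₀ x (by linarith : (n : ℝ) ≠ 0)] using hpow n

variable {Ω : Type*} [MeasurableSpace Ω] {P : Measure Ω} {T : Ω → ℝ} {g : ℝ → ℝ}

lemma hazardRate_le_hazardSup (hb : BddAbove (hazardRate P T g '' Set.Ici 0)) {x : ℝ}
    (hx : 0 ≤ x) : hazardRate P T g x ≤ hazardSup P T g :=
  le_csSup hb ⟨x, hx, rfl⟩

lemma IsDensity.nullSingletonClass_map (hg : IsDensity P T g) : NullSingletonClass (P.map T) := by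
  rw [hg.map_eq]
  infer_instance

variable [IsProbabilityMeasure P]

lemma measureReal_lt_eq_one_sub (hT : Measurable T) (x : ℝ) :
    P.real {ω | x < T ω} = 1 - P.real {ω | T ω ≤ x} := by
  rw [← probReal_compl_eq_one_sub (measurableSet_le hT measurable_const)]
  congr 1; ext; simp

lemma antitone_survival : Antitone fun x => P.real {ω | x < T ω} :=
  fun _ _ hxy => measureReal_mono fun _ hω => lt_of_le_of_lt hxy hω

lemma hazardSup_nonneg (hg : IsDensity P T g)
    (hb : BddAbove (hazardRate P T g '' Set.Ici 0)) : 0 ≤ hazardSup P T g :=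
  (div_nonneg (hg.nonneg 0) (sub_nonneg.2 measureReal_le_one)).trans
    (hazardRate_le_hazardSup hb le_rfl)

lemma IsDensity.ae_le_hazardSup_mul_survival (hg : IsDensity P T g) (hT : Measurable T)
    (hb : BddAbove (hazardRate P T g '' Set.Ici 0)) :
    ∀ᵐ y, 0 ≤ y → g y ≤ hazardSup P T g * P.real {ω | y < T ω} := by
  have := hg.nullSingletonClass_map
  -- Where the survival function vanishes, `hazardRate` divides by zero and says nothing about `g`.
  have hnull : volume ({y | ENNReal.ofReal (g y) ≠ 0} ∩ {y | P.map T (Set.Ioi y) = 0}) = 0 := by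
    rw [← withDensity_apply_eq_zero hg.measurable.ennreal_ofReal, ← hg.map_eq]
    exact measure_setOf_measure_Ioi_eq_zero _
  filter_upwards [measure_eq_zero_iff_ae_notMem.1 hnull] with y hy hy0
  rcases (measureReal_nonneg : 0 ≤ P.real {ω | y < T ω}).eq_or_lt with hzero | hpos
  · have hmap : P.map T (Set.Ioi y) = 0 := by
      rw [Measure.map_apply hT measurableSet_Ioi]
      exact (measureReal_eq_zero_iff).1 hzero.symm
    simpa [← hzero, hmap] using hy
  · have hrate := hazardRate_le_hazardSup hb hy0
    rwa [hazardRate, ← measureReal_lt_eq_one_sub hT, div_le_iff₀ hpos] at hrate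

lemma IsDensity.survival_add_ge (hg : IsDensity P T g) (hT : Measurable T)
    (hb : BddAbove (hazardRate P T g '' Set.Ici 0)) {x d : ℝ} (hx : 0 ≤ x) (hd : 0 ≤ d) :
    (1 - hazardSup P T g * d) * P.real {ω | x < T ω} ≤ P.real {ω | x + d < T ω} := by
  have hη := hazardSup_nonneg hg hb
  set F := P.real {ω | x < T ω}
  have hinterval : P {ω | T ω ∈ Set.Ioc x (x + d)} ≤ ENNReal.ofReal (hazardSup P T g * F * d) :=
    calc P {ω | T ω ∈ Set.Ioc x (x + d)}
        = ∫⁻ y in Set.Ioc x (x + d), ENNReal.ofReal (g y) := by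
          rw [← withDensity_apply _ measurableSet_Ioc, ← hg.map_eq,
            Measure.map_apply hT measurableSet_Ioc]
          rfl
      _ ≤ ∫⁻ _ in Set.Ioc x (x + d), ENNReal.ofReal (hazardSup P T g * F) := by
          refine setLIntegral_mono_ae' measurableSet_Ioc ?_
          filter_upwards [hg.ae_le_hazardSup_mul_survival hT hb] with y hy hxy
          exact ENNReal.ofReal_le_ofReal ((hy (hx.trans hxy.1.le)).trans
            (mul_le_mul_of_nonneg_left (antitone_survival hxy.1.le) hη))
      _ = ENNReal.ofReal (hazardSup P T g * F * d) := by
          rw [setLIntegral_const, Real.volume_Ioc, add_sub_cancel_left,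
            ENNReal.ofReal_mul (mul_nonneg hη measureReal_nonneg)]
  have hreal : P.real {ω | T ω ∈ Set.Ioc x (x + d)} ≤ hazardSup P T g * F * d :=
    ENNReal.toReal_le_of_le_ofReal (by positivity) hinterval
  have hsplit : F ≤ P.real {ω | T ω ∈ Set.Ioc x (x + d)} + P.real {ω | x + d < T ω} := by
    refine (measureReal_mono fun ω hω => ?_).trans (measureReal_union_le _ _)
    exact (le_or_gt (T ω) (x + d)).imp (fun h => ⟨hω, h⟩) id
  linarith

lemma IsDensity.exp_neg_le_survival (hg : IsDensity P T g) (hT : Measurable T)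
    (h0 : ∀ᵐ ω ∂P, 0 ≤ T ω) (hb : BddAbove (hazardRate P T g '' Set.Ici 0)) {x : ℝ}
    (hx : 0 ≤ x) : Real.exp (-(hazardSup P T g * x)) ≤ P.real {ω | x < T ω} := by
  refine exp_neg_mul_le_of_one_sub_mul_le (G := fun x => P.real {ω | x < T ω})
    ?_ (fun x d => hg.survival_add_ge hT hb) hx
  have := hg.nullSingletonClass_map
  have hne : ∀ᵐ ω ∂P, T ω ≠ 0 :=
    ae_of_ae_map hT.aemeasurable (Measure.ae_ne (P.map T) 0)
  have hpos : ∀ᵐ ω ∂P, 0 < T ω := by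
    filter_upwards [h0, hne] with ω hω hω' using hω.lt_of_ne' hω'
  rw [measureReal_def, (mem_ae_iff_prob_eq_one (measurableSet_lt measurable_const hT)).1 hpos,
    ENNReal.toReal_one]

end Survival

/-! ### Moments of the waiting times -/

lemma memLp_of_integrable_pow {α : Type*} [MeasurableSpace α] {μ : Measure α} {f : α → ℝ} {k : ℕ}
    (hk : k ≠ 0) (hf : AEStronglyMeasurable f μ) (hi : Integrable (fun x => f x ^ k) μ) :
    MemLp f k μ := by
  rw [← integrable_norm_rpow_iff hf (by simpa using hk) (by simp)]
  simpa [← norm_pow] using hi.norm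

lemma integrable_pow_of_memLp {α : Type*} [MeasurableSpace α] {μ : Measure α} [IsFiniteMeasure μ]
    {f : α → ℝ} {j k : ℕ} (hf : MemLp f k μ) (hjk : j ≤ k) : Integrable (fun x => f x ^ j) μ := by
  refine (integrable_norm_iff (hf.aestronglyMeasurable.pow j)).1 ?_
  simpa using (hf.mono_exponent (p := (j : ENNReal)) (by exact_mod_cast hjk)).integrable_norm_pow'

lemma sq_integral_le_integral_sq {Ω : Type*} [MeasurableSpace Ω] {P : Measure Ω}
    [IsProbabilityMeasure P] {f : Ω → ℝ} (hf : MemLp f 2 P) :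
    (∫ ω, f ω ∂P) ^ 2 ≤ ∫ ω, f ω ^ 2 ∂P := by
  have := variance_nonneg f P
  rw [variance_eq_sub hf] at this
  simpa using this

namespace IsQueue

variable {Ω : Type*} [MeasurableSpace Ω] {P : Measure Ω} {U S : ℕ → Ω → ℝ}

lemma memLp_U (h : IsQueue P U S) : MemLp (U 0) 3 P :=
  memLp_of_integrable_pow three_ne_zero (h.measurable_U 0).aestronglyMeasurable h.integrable_U

lemma memLp_S (h : IsQueue P U S) : MemLp (S 0) 3 P :=
  memLp_of_integrable_pow three_ne_zero (h.measurable_S 0).aestronglyMeasurable h.integrable_S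

lemma memLp_sub (h : IsQueue P U S) : MemLp (fun ω => S 0 ω - U 0 ω) 3 P := h.memLp_S.sub h.memLp_U

variable [IsProbabilityMeasure P]

lemma integrable_U_pow (h : IsQueue P U S) {k : ℕ} (hk : k ≤ 3) :
    Integrable (fun ω => U 0 ω ^ k) P := integrable_pow_of_memLp h.memLp_U hk

lemma integrable_S_pow (h : IsQueue P U S) {k : ℕ} (hk : k ≤ 3) :
    Integrable (fun ω => S 0 ω ^ k) P := integrable_pow_of_memLp h.memLp_S hk

lemma integrable_sub (h : IsQueue P U S) : Integrable (fun ω => S 0 ω - U 0 ω) P :=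
  h.memLp_sub.integrable (by norm_num)

lemma integrable_sub_sq (h : IsQueue P U S) : Integrable (fun ω => (S 0 ω - U 0 ω) ^ 2) P :=
  integrable_pow_of_memLp h.memLp_sub (by norm_num)

lemma memLp_waitingTime (h : IsQueue P U S) (n : ℕ) : MemLp (waitingTime U S n) 2 P := by
  induction n with
  | zero =>
    rw [show waitingTime U S 0 = 0 from funext waitingTime_zero]
    exact MemLp.zero
  | succ n ih =>
    have hξ : MemLp (fun ω => S n ω - U n ω) 2 P :=
      ((h.identDistrib_pair n).comp (u := fun p : ℝ × ℝ => p.2 - p.1)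
        (by fun_prop)).memLp_iff.2 (h.memLp_sub.mono_exponent (by norm_num))
    refine (ih.add hξ).mono (h.measurable_waitingTime _).aestronglyMeasurable
      (Eventually.of_forall fun ω => ?_)
    rw [waitingTime_succ, Real.norm_eq_abs, Real.norm_eq_abs, abs_of_nonneg (le_max_right _ _)]
    exact max_le (le_abs_self _) (abs_nonneg _)

lemma integrable_waitingTime (h : IsQueue P U S) (n : ℕ) : Integrable (waitingTime U S n) P :=
  (h.memLp_waitingTime n).integrable (by norm_num)

lemma integral_waitingTime_succ_sq_le (h : IsQueue P U S) (n : ℕ) :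
    ∫ ω, waitingTime U S (n + 1) ω ^ 2 ∂P
      ≤ ∫ ω, waitingTime U S n ω ^ 2 ∂P
        + 2 * ((∫ ω, waitingTime U S n ω ∂P) * ∫ ω, (S 0 ω - U 0 ω) ∂P)
        + ∫ ω, (S 0 ω - U 0 ω) ^ 2 ∂P := by
  have hmξ : Measurable fun p : ℝ × ℝ => p.2 - p.1 := by fun_prop
  have hmξ2 : Measurable fun p : ℝ × ℝ => (p.2 - p.1) ^ 2 := by fun_prop
  have hW2 := (h.memLp_waitingTime n).integrable_sq
  have hWξ : Integrable (fun ω => waitingTime U S n ω * (S n ω - U n ω)) P :=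
    h.integrable_waitingTime_mul n measurable_id hmξ (h.integrable_waitingTime n) h.integrable_sub
  have hξ2 : Integrable (fun ω => (S n ω - U n ω) ^ 2) P :=
    h.integrable_pair n hmξ2 h.integrable_sub_sq
  have hcross : ∫ ω, waitingTime U S n ω * (S n ω - U n ω) ∂P
      = (∫ ω, waitingTime U S n ω ∂P) * ∫ ω, (S 0 ω - U 0 ω) ∂P :=
    h.integral_waitingTime_mul n measurable_id hmξ
  have hsq : ∫ ω, (S n ω - U n ω) ^ 2 ∂P = ∫ ω, (S 0 ω - U 0 ω) ^ 2 ∂P := h.integral_pair n hmξ2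
  have hlinear : Integrable (fun ω =>
      waitingTime U S n ω ^ 2 + 2 * (waitingTime U S n ω * (S n ω - U n ω))) P :=
    hW2.add (hWξ.const_mul 2)
  rw [← hcross, ← hsq, ← integral_const_mul, ← integral_add hW2 (hWξ.const_mul 2),
    ← integral_add hlinear hξ2]
  refine integral_mono (h.memLp_waitingTime _).integrable_sq (hlinear.add hξ2) fun ω => ?_
  calc waitingTime U S (n + 1) ω ^ 2 ≤ (waitingTime U S n ω + (S n ω - U n ω)) ^ 2 := by
        rw [waitingTime_succ, sq_le_sq, abs_of_nonneg (le_max_right _ _)]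
        exact max_le (le_abs_self _) (abs_nonneg _)
    _ = _ := by ring

lemma integral_waitingTime_sq_le (h : IsQueue P U S)
    (hd : ∫ ω, (S 0 ω - U 0 ω) ∂P ≤ 0) (n : ℕ) :
    ∫ ω, waitingTime U S n ω ^ 2 ∂P ≤ n * ∫ ω, (S 0 ω - U 0 ω) ^ 2 ∂P := by
  induction n with
  | zero => simp
  | succ n ih =>
    have hW : 0 ≤ ∫ ω, waitingTime U S n ω ∂P := integral_nonneg fun ω => waitingTime_nonneg n ω
    push_cast
    linarith [h.integral_waitingTime_succ_sq_le n, mul_nonpos_of_nonneg_of_nonpos hW hd]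

lemma tendsto_integral_waitingTime_div (h : IsQueue P U S)
    (hd : ∫ ω, (S 0 ω - U 0 ω) ∂P ≤ 0) :
    Tendsto (fun n : ℕ => (∫ ω, waitingTime U S n ω ∂P) / n) atTop (𝓝 0) := by
  set v := ∫ ω, (S 0 ω - U 0 ω) ^ 2 ∂P
  have hlim : Tendsto (fun n : ℕ => √(v * (1 / (n : ℝ)))) atTop (𝓝 0) := by
    simpa using ((tendsto_one_div_atTop_nhds_zero_nat (𝕜 := ℝ)).const_mul v).sqrt
  refine squeeze_zero' (Eventually.of_forall fun n => ?_) ?_ hlim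
  · exact div_nonneg (integral_nonneg fun ω => waitingTime_nonneg n ω) n.cast_nonneg
  · filter_upwards [eventually_gt_atTop 0] with n hn
    have hn : (0 : ℝ) < n := by exact_mod_cast hn
    refine Real.le_sqrt_of_sq_le ?_
    have hsq : (∫ ω, waitingTime U S n ω ∂P) ^ 2 ≤ n * v :=
      (sq_integral_le_integral_sq (h.memLp_waitingTime n)).trans (h.integral_waitingTime_sq_le hd n)
    rw [div_pow, mul_one_div, div_le_div_iff₀ (by positivity) hn]
    nlinarith

lemma integrable_idleTime (h : IsQueue P U S) (n : ℕ) : Integrable (idleTime U S n) P := by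
  have hidle : idleTime U S n
      = fun ω => waitingTime U S (n + 1) ω - (waitingTime U S n ω + (S n ω - U n ω)) := by
    ext ω; rw [waitingTime_succ_eq_add_idleTime]; ring
  rw [hidle]
  exact (h.integrable_waitingTime _).sub ((h.integrable_waitingTime n).add
    (h.integrable_pair n (ψ := fun p => p.2 - p.1) (by fun_prop) h.integrable_sub))

lemma sum_integral_idleTime (h : IsQueue P U S) (n : ℕ) :
    ∑ k ∈ Finset.range n, ∫ ω, idleTime U S k ω ∂P
      = ∫ ω, waitingTime U S n ω ∂P - n * ∫ ω, (S 0 ω - U 0 ω) ∂P := by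
  induction n with
  | zero => simp
  | succ n ih =>
    have hmξ : Measurable fun p : ℝ × ℝ => p.2 - p.1 := by fun_prop
    have hξ : Integrable (fun ω => S n ω - U n ω) P := h.integrable_pair n hmξ h.integrable_sub
    have hmean : ∫ ω, (S n ω - U n ω) ∂P = ∫ ω, (S 0 ω - U 0 ω) ∂P := h.integral_pair n hmξ
    have hWξ : Integrable (fun ω => waitingTime U S n ω + (S n ω - U n ω)) P :=
      (h.integrable_waitingTime n).add hξ
    rw [Finset.sum_range_succ, ih]
    simp_rw [waitingTime_succ_eq_add_idleTime n]
    rw [integral_add hWξ (h.integrable_idleTime n),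
      integral_add (h.integrable_waitingTime n) hξ, hmean]
    push_cast; ring

end IsQueue

/-! ### Second moments of the idle times -/

/-- The expected number of customers among the first `n` whose waiting time is at most `x`, the
renewal function of the waiting times. -/
noncomputable def waitingCount {Ω : Type*} [MeasurableSpace Ω] (P : Measure Ω) (U S : ℕ → Ω → ℝ)
    (n : ℕ) (x : ℝ) : ℝ :=
  ∑ k ∈ Finset.range n, P.real {ω | waitingTime U S k ω ≤ x}

section WaitingCount

variable {Ω : Type*} [MeasurableSpace Ω] {P : Measure Ω} {U S : ℕ → Ω → ℝ}

lemma waitingCount_nonneg (n : ℕ) (x : ℝ) : 0 ≤ waitingCount P U S n x :=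
  Finset.sum_nonneg fun _ _ => measureReal_nonneg

lemma waitingCount_of_neg (n : ℕ) {x : ℝ} (hx : x < 0) : waitingCount P U S n x = 0 := by
  refine Finset.sum_eq_zero fun k _ => ?_
  have : {ω | waitingTime U S k ω ≤ x} = ∅ := by
    ext ω
    simpa using hx.trans_le (waitingTime_nonneg k ω)
  simp [this]

lemma waitingCount_le_succ (n : ℕ) (x : ℝ) :
    waitingCount P U S n x ≤ waitingCount P U S (n + 1) x := by
  rw [waitingCount, waitingCount, Finset.sum_range_succ]
  exact le_add_of_nonneg_right measureReal_nonneg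

lemma waitingCount_mono [IsFiniteMeasure P] (n : ℕ) : Monotone (waitingCount P U S n) :=
  fun _ _ hxy => Finset.sum_le_sum fun _ _ => monotone_measureReal_le _ hxy

lemma waitingCount_le [IsProbabilityMeasure P] (n : ℕ) (x : ℝ) : waitingCount P U S n x ≤ n := by
  simpa [waitingCount] using Finset.sum_le_card_nsmul (Finset.range n)
    (fun k => P.real {ω | waitingTime U S k ω ≤ x}) 1 fun _ _ => measureReal_le_one

end WaitingCount

namespace IsQueue

variable {Ω : Type*} [MeasurableSpace Ω] {P : Measure Ω} {U S : ℕ → Ω → ℝ} [IsProbabilityMeasure P]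

lemma integrable_waitingCount (h : IsQueue P U S) (n : ℕ) (x : ℝ) :
    Integrable (fun ω => waitingCount P U S n (x - (S 0 ω - U 0 ω))) P := by
  refine Integrable.of_bound (C := n) ((waitingCount_mono n).measurable.comp
    (measurable_const.sub ((h.measurable_S 0).sub (h.measurable_U 0)))).aestronglyMeasurable
    (Eventually.of_forall fun ω => ?_)
  rw [Real.norm_eq_abs, abs_of_nonneg (waitingCount_nonneg _ _)]
  exact waitingCount_le _ _

lemma measureReal_waitingTime_succ_le (h : IsQueue P U S) (k : ℕ) {x : ℝ} (hx : 0 ≤ x) :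
    P.real {ω | waitingTime U S (k + 1) ω ≤ x}
      = ∫ ω, P.real {ω' | waitingTime U S k ω' ≤ x - (S 0 ω - U 0 ω)} ∂P := by
  have hcdf := h.integral_mul_indicator_waitingTime_le k (F := fun _ => 1)
    (G := fun p => x - (p.2 - p.1)) measurable_const (by fun_prop) (integrable_const 1)
  simp only [one_mul] at hcdf
  have hmeas : MeasurableSet {ω | waitingTime U S k ω ≤ x - (S k ω - U k ω)} :=
    measurableSet_le (h.measurable_waitingTime k)
      (measurable_const.sub ((h.measurable_S k).sub (h.measurable_U k)))
  rw [← hcdf, integral_indicator_one hmeas]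
  congr 1
  ext ω
  simp only [Set.mem_ofPred_eq, waitingTime_succ, max_le_iff, hx, and_true, le_sub_iff_add_le]

lemma waitingCount_succ (h : IsQueue P U S) (n : ℕ) {x : ℝ} (hx : 0 ≤ x) :
    waitingCount P U S (n + 1) x
      = 1 + ∫ ω, waitingCount P U S n (x - (S 0 ω - U 0 ω)) ∂P := by
  have hfirst : P.real {ω | waitingTime U S 0 ω ≤ x} = 1 := by simp [hx]
  rw [waitingCount, Finset.sum_range_succ', hfirst, add_comm,
    Finset.sum_congr rfl fun k _ => h.measureReal_waitingTime_succ_le k hx]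
  unfold waitingCount
  rw [integral_finsetSum]
  intro k _
  refine Integrable.of_bound (C := 1) ((monotone_measureReal_le _).measurable.comp
    (measurable_const.sub ((h.measurable_S 0).sub (h.measurable_U 0)))).aestronglyMeasurable
    (Eventually.of_forall fun ω => ?_)
  rw [Real.norm_eq_abs, abs_of_nonneg measureReal_nonneg]
  exact measureReal_le_one

lemma waitingCount_add_one_le (h : IsQueue P U S) (n : ℕ) (x : ℝ) :
    waitingCount P U S n (x + 1) ≤ waitingCount P U S n x + waitingCount P U S n 1 := by
  induction n generalizing x with
  | zero => simp [waitingCount]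
  | succ n ih =>
    rcases lt_or_ge x 0 with hx | hx
    · rw [waitingCount_of_neg _ hx, zero_add]
      exact waitingCount_mono _ (by linarith)
    · have hshift : ∫ ω, waitingCount P U S n (x + 1 - (S 0 ω - U 0 ω)) ∂P
          ≤ ∫ ω, (waitingCount P U S n (x - (S 0 ω - U 0 ω)) + waitingCount P U S n 1) ∂P := by
        refine integral_mono (h.integrable_waitingCount n _)
          ((h.integrable_waitingCount n _).add (integrable_const _)) fun ω => ?_
        simpa only [sub_add_eq_add_sub] using ih (x - (S 0 ω - U 0 ω))
      rw [integral_add (h.integrable_waitingCount n _) (integrable_const _), integral_const,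
        probReal_univ, one_smul] at hshift
      rw [h.waitingCount_succ n hx, h.waitingCount_succ n (by linarith : 0 ≤ x + 1)]
      linarith [waitingCount_le_succ (P := P) (U := U) (S := S) n 1]

lemma waitingCount_le_mul (h : IsQueue P U S) (n : ℕ) {x : ℝ} (hx : 0 ≤ x) :
    waitingCount P U S n x ≤ (x + 1) * waitingCount P U S n 1 := by
  have hnat (m : ℕ) : waitingCount P U S n (m + 1) ≤ (m + 1) * waitingCount P U S n 1 := by
    induction m with
    | zero => simp
    | succ m ih =>
      push_cast
      linarith [h.waitingCount_add_one_le n (m + 1)]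
  calc waitingCount P U S n x ≤ waitingCount P U S n (⌊x⌋₊ + 1) :=
        waitingCount_mono n (Nat.lt_floor_add_one x).le
    _ ≤ (⌊x⌋₊ + 1) * waitingCount P U S n 1 := hnat _
    _ ≤ (x + 1) * waitingCount P U S n 1 :=
        mul_le_mul_of_nonneg_right (by linarith [Nat.floor_le hx]) (waitingCount_nonneg _ _)

lemma integrable_sq_mul_measureReal (h : IsQueue P U S) (k : ℕ) :
    Integrable (fun ω => U 0 ω ^ 2 * P.real {ω' | waitingTime U S k ω' ≤ U 0 ω}) P := by
  refine (h.integrable_U_pow (by norm_num : 2 ≤ 3)).mul_bdd (c := 1)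
    ((monotone_measureReal_le _).measurable.comp (h.measurable_U 0)).aestronglyMeasurable
    (Eventually.of_forall fun ω => ?_)
  rw [Real.norm_eq_abs, abs_of_nonneg measureReal_nonneg]
  exact measureReal_le_one

lemma integral_idleTime_sq_le (h : IsQueue P U S) (k : ℕ) :
    ∫ ω, idleTime U S k ω ^ 2 ∂P
      ≤ ∫ ω, U 0 ω ^ 2 * P.real {ω' | waitingTime U S k ω' ≤ U 0 ω} ∂P := by
  have hU2 := h.integrable_U_pow (by norm_num : 2 ≤ 3)
  have hmU2 : Measurable fun p : ℝ × ℝ => p.1 ^ 2 := by fun_prop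
  have hU2k : Integrable (fun ω => U k ω ^ 2) P := h.integrable_pair k hmU2 hU2
  rw [← h.integral_mul_indicator_waitingTime_le k hmU2 measurable_fst hU2]
  simp only [Set.indicator, Set.mem_ofPred_eq, Pi.one_apply, mul_ite, mul_one, mul_zero]
  refine integral_mono_of_nonneg (Eventually.of_forall fun ω => sq_nonneg _)
    (hU2k.indicator (measurableSet_le (h.measurable_waitingTime k) (h.measurable_U k))) ?_
  filter_upwards [h.nonneg_pair k] with ω ⟨hU, hS⟩
  have hW := waitingTime_nonneg (U := U) (S := S) k ω
  split_ifs with hWU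
  · exact pow_le_pow_left₀ (idleTime_nonneg k ω) (max_le (by linarith) hU) 2
  · rw [idleTime, max_eq_right (by linarith), sq, mul_zero]

lemma sum_integral_idleTime_sq_le_waitingCount (h : IsQueue P U S) (n : ℕ) :
    ∑ k ∈ Finset.range n, ∫ ω, idleTime U S k ω ^ 2 ∂P
      ≤ (∫ ω, U 0 ω ^ 2 ∂P + ∫ ω, U 0 ω ^ 3 ∂P) * waitingCount P U S n 1 := by
  have hU2 := h.integrable_U_pow (by norm_num : 2 ≤ 3)
  have hcount : Integrable (fun ω => U 0 ω ^ 2 * waitingCount P U S n (U 0 ω)) P := by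
    simp_rw [waitingCount, Finset.mul_sum]
    exact integrable_finsetSum _ fun k _ => h.integrable_sq_mul_measureReal k
  calc ∑ k ∈ Finset.range n, ∫ ω, idleTime U S k ω ^ 2 ∂P
      ≤ ∑ k ∈ Finset.range n, ∫ ω, U 0 ω ^ 2 *
          P.real {ω' | waitingTime U S k ω' ≤ U 0 ω} ∂P :=
        Finset.sum_le_sum fun k _ => h.integral_idleTime_sq_le k
    _ = ∫ ω, U 0 ω ^ 2 * waitingCount P U S n (U 0 ω) ∂P := by
        rw [← integral_finsetSum _ fun k _ => h.integrable_sq_mul_measureReal k]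
        simp_rw [waitingCount, Finset.mul_sum]
    _ ≤ ∫ ω, (U 0 ω ^ 2 + U 0 ω ^ 3) * waitingCount P U S n 1 ∂P := by
        refine integral_mono_ae hcount ((hU2.add h.integrable_U).mul_const _) ?_
        filter_upwards [h.nonneg_U 0] with ω hω
        calc U 0 ω ^ 2 * waitingCount P U S n (U 0 ω)
            ≤ U 0 ω ^ 2 * ((U 0 ω + 1) * waitingCount P U S n 1) :=
              mul_le_mul_of_nonneg_left (h.waitingCount_le_mul n hω) (sq_nonneg _)
          _ = _ := by ring
    _ = _ := by rw [integral_mul_const, integral_add hU2 h.integrable_U]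

lemma half_le_measureReal_S_le (h : IsQueue P U S) :
    1 / 2 ≤ P.real {ω | S 0 ω ≤ 2 * ∫ ω, S 0 ω ∂P + 1} := by
  set b := ∫ ω, S 0 ω ∂P
  have hb : 0 ≤ b := integral_nonneg_of_ae (h.nonneg_S 0)
  have hmarkov : (2 * b + 1) * P.real {ω | 2 * b + 1 ≤ S 0 ω} ≤ b :=
    mul_meas_ge_le_integral_of_nonneg (h.nonneg_S 0) (h.memLp_S.integrable (by norm_num)) _
  have hcompl := measureReal_lt_eq_one_sub (P := P) (h.measurable_S 0) (2 * b + 1)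
  have hlt : P.real {ω | 2 * b + 1 < S 0 ω} ≤ P.real {ω | 2 * b + 1 ≤ S 0 ω} :=
    measureReal_mono fun ω (hω : 2 * b + 1 < S 0 ω) => (hω.le : 2 * b + 1 ≤ S 0 ω)
  nlinarith

-- A short waiting time, a short service time and a long interarrival time lead to idling.
lemma measureReal_waitingTime_le_one_mul_le (h : IsQueue P U S) (k : ℕ) :
    P.real {ω | waitingTime U S k ω ≤ 1} *
        (1 / 2 * P.real {ω | 2 * ∫ ω, S 0 ω ∂P + 3 < U 0 ω})
      ≤ ∫ ω, idleTime U S k ω ∂P := by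
  set b := ∫ ω, S 0 ω ∂P
  set B : Set (ℝ × ℝ) := Set.Ioi (2 * b + 3) ×ˢ Set.Iic (2 * b + 1)
  have hB : MeasurableSet B := measurableSet_Ioi.prod measurableSet_Iic
  have hprod : P.real {ω | (U 0 ω, S 0 ω) ∈ B}
      = P.real {ω | 2 * b + 3 < U 0 ω} * P.real {ω | S 0 ω ≤ 2 * b + 1} := by
    rw [measureReal_def, measureReal_def, measureReal_def, ← ENNReal.toReal_mul]
    exact congrArg ENNReal.toReal ((h.indepFun_U_S 0).measure_inter_preimage_eq_mul _ _
      (measurableSet_Ioi (a := 2 * b + 3)) (measurableSet_Iic (a := 2 * b + 1)))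
  have hindep : P.real ({ω | waitingTime U S k ω ≤ 1} ∩ {ω | (U k ω, S k ω) ∈ B})
      = P.real {ω | waitingTime U S k ω ≤ 1} * P.real {ω | (U 0 ω, S 0 ω) ∈ B} := by
    have hlaw : P {ω | (U k ω, S k ω) ∈ B} = P {ω | (U 0 ω, S 0 ω) ∈ B} :=
      (h.identDistrib_pair k).measure_mem_eq hB
    rw [measureReal_def, measureReal_def, measureReal_def, ← hlaw, ← ENNReal.toReal_mul]
    exact congrArg ENNReal.toReal ((h.indepFun_waitingTime k).measure_inter_preimage_eq_mul _ _
      (measurableSet_Iic (a := (1 : ℝ))) hB)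
  calc P.real {ω | waitingTime U S k ω ≤ 1} * (1 / 2 * P.real {ω | 2 * b + 3 < U 0 ω})
      ≤ P.real {ω | waitingTime U S k ω ≤ 1} * P.real {ω | (U 0 ω, S 0 ω) ∈ B} := by
        rw [hprod, mul_comm (1 / 2)]
        gcongr
        exact h.half_le_measureReal_S_le
    _ = P.real ({ω | waitingTime U S k ω ≤ 1} ∩ {ω | (U k ω, S k ω) ∈ B}) := hindep.symm
    _ ≤ P.real {ω | 1 ≤ idleTime U S k ω} := by
        refine measureReal_mono ?_
        rintro ω ⟨hW, hU, hS⟩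
        simp only [Set.mem_ofPred_eq, Set.mem_Ioi, Set.mem_Iic] at hW hU hS
        exact le_max_of_le_left
          (by linarith : 1 ≤ U k ω - S k ω - waitingTime U S k ω)
    _ ≤ ∫ ω, idleTime U S k ω ∂P := by
        simpa using mul_meas_ge_le_integral_of_nonneg
          (Eventually.of_forall fun ω => idleTime_nonneg k ω) (h.integrable_idleTime k) 1

lemma sum_integral_idleTime_sq_le (h : IsQueue P U S) {p : ℝ} (hp : 0 < p)
    (hpU : p ≤ P.real {ω | 2 * ∫ ω, S 0 ω ∂P + 3 < U 0 ω}) (n : ℕ) :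
    ∑ k ∈ Finset.range n, ∫ ω, idleTime U S k ω ^ 2 ∂P
      ≤ 2 * (∫ ω, U 0 ω ^ 2 ∂P + ∫ ω, U 0 ω ^ 3 ∂P) / p *
          ∑ k ∈ Finset.range n, ∫ ω, idleTime U S k ω ∂P := by
  have hu : 0 ≤ ∫ ω, U 0 ω ^ 2 ∂P + ∫ ω, U 0 ω ^ 3 ∂P :=
    add_nonneg (integral_nonneg fun ω => sq_nonneg _)
      (integral_nonneg_of_ae ((h.nonneg_U 0).mono fun ω hω => pow_nonneg hω 3))
  have hshort : waitingCount P U S n 1 * (1 / 2 * p)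
      ≤ ∑ k ∈ Finset.range n, ∫ ω, idleTime U S k ω ∂P := by
    rw [waitingCount, Finset.sum_mul]
    refine Finset.sum_le_sum fun k _ => le_trans ?_ (h.measureReal_waitingTime_le_one_mul_le k)
    gcongr
  calc _ ≤ (∫ ω, U 0 ω ^ 2 ∂P + ∫ ω, U 0 ω ^ 3 ∂P) * waitingCount P U S n 1 :=
        h.sum_integral_idleTime_sq_le_waitingCount n
    _ ≤ (∫ ω, U 0 ω ^ 2 ∂P + ∫ ω, U 0 ω ^ 3 ∂P) *
          (2 / p * ∑ k ∈ Finset.range n, ∫ ω, idleTime U S k ω ∂P) := by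
        refine mul_le_mul_of_nonneg_left ?_ hu
        rw [div_mul_eq_mul_div, le_div_iff₀ hp]
        linarith
    _ = _ := by ring

end IsQueue

/-! ### Stein's equation for the exponential distribution -/

lemma abs_integral_le_of_abs_le {α : Type*} [MeasurableSpace α] {μ : Measure α}
    [IsProbabilityMeasure μ] {f : α → ℝ} {B : ℝ} (hB : ∀ᵐ x ∂μ, |f x| ≤ B) : |∫ x, f x ∂μ| ≤ B := by
  simpa using norm_integral_le_of_norm_le_const (f := f) (μ := μ) hB

section Exponential

variable {r : ℝ}

lemma expMeasure_eq_withDensity (r : ℝ) :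
    expMeasure r = (volume.restrict (Set.Ioi 0)).withDensity
      fun x => ENNReal.ofReal (r * Real.exp (-(r * x))) := by
  rw [← withDensity_indicator measurableSet_Ioi]
  change volume.withDensity (gammaPDF 1 r) = _
  refine withDensity_congr_ae ?_
  filter_upwards [volume.ae_ne 0] with x hx
  change exponentialPDF r x = _
  rw [exponentialPDF_eq]
  rcases lt_or_gt_of_ne hx with h | h
  · simp [Set.indicator, not_le.2 h, not_lt.2 h.le]
  · simp [Set.indicator, h.le, h]

lemma integral_expMeasure (hr : 0 < r) (f : ℝ → ℝ) :
    ∫ x, f x ∂(expMeasure r) = ∫ x in Set.Ioi 0, r * Real.exp (-(r * x)) * f x := by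
  rw [expMeasure_eq_withDensity, integral_withDensity_eq_integral_toReal_smul (by fun_prop)
    (Eventually.of_forall fun _ => ENNReal.ofReal_lt_top)]
  refine integral_congr_ae (Eventually.of_forall fun x => ?_)
  simp only [smul_eq_mul]
  rw [ENNReal.toReal_ofReal (by positivity)]

lemma integrable_expMeasure_iff (hr : 0 < r) (f : ℝ → ℝ) :
    Integrable f (expMeasure r)
      ↔ IntegrableOn (fun x => r * Real.exp (-(r * x)) * f x) (Set.Ioi 0) := by
  rw [expMeasure_eq_withDensity, integrable_withDensity_iff_integrable_smul' (by fun_prop)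
    (Eventually.of_forall fun _ => ENNReal.ofReal_lt_top), IntegrableOn]
  refine integrable_congr (Eventually.of_forall fun x => ?_)
  simp only [smul_eq_mul]
  rw [ENNReal.toReal_ofReal (by positivity)]

lemma integrable_id_expMeasure (hr : 0 < r) : Integrable (fun x => x) (expMeasure r) := by
  rw [integrable_expMeasure_iff hr]
  refine ((integrableOn_rpow_mul_exp_neg_mul_rpow (p := 1) (s := 1) (by norm_num)
    (by norm_num) hr).const_mul r).congr (Eventually.of_forall fun x => ?_)
  simp only [Real.rpow_one, neg_mul]
  ring

end Exponential

section Stein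

variable {r B C L : ℝ} {h h' : ℝ → ℝ}

/-- The function `x ↦ E h(Y) - E h(x + Y)` with `Y` exponential of rate `r`: the derivative of the
solution of the Stein equation for the exponential distribution. -/
noncomputable def steinSol (r : ℝ) (h : ℝ → ℝ) (x : ℝ) : ℝ :=
  ∫ y, h y ∂(expMeasure r) - ∫ y, h (x + y) ∂(expMeasure r)

/-- The derivative of `steinSol r h`, expressed through the derivative `h'` of `h`. -/
noncomputable def steinSolDeriv (r : ℝ) (h' : ℝ → ℝ) (x : ℝ) : ℝ :=
  -∫ y, h' (x + y) ∂(expMeasure r)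

lemma steinSol_zero : steinSol r h 0 = 0 := by simp [steinSol]

lemma integrable_comp_const_add_expMeasure (hr : 0 < r) {f : ℝ → ℝ} (hf : Measurable f)
    (hB : ∀ x, |f x| ≤ B) (x : ℝ) : Integrable (fun y => f (x + y)) (expMeasure r) := by
  have := isProbabilityMeasure_expMeasure hr
  exact Integrable.of_bound (hf.comp (measurable_const_add x)).aestronglyMeasurable B
    (Eventually.of_forall fun y => hB _)

lemma hasDerivAt_steinSol (hr : 0 < r) (hd : ∀ x, HasDerivAt h (h' x) x) (hB : ∀ x, |h x| ≤ B)
    (hC : ∀ x, |h' x| ≤ C) (hm : Measurable h') (x : ℝ) :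
    HasDerivAt (steinSol r h) (steinSolDeriv r h' x) x := by
  have := isProbabilityMeasure_expMeasure hr
  have hc : Continuous h := continuous_iff_continuousAt.2 fun x => (hd x).continuousAt
  refine HasDerivAt.const_sub _ ?_
  refine (hasDerivAt_integral_of_dominated_loc_of_deriv_le (F := fun x y => h (x + y))
    (F' := fun x y => h' (x + y)) (bound := fun _ => C) univ_mem
    (Eventually.of_forall fun z => ?_) ?_ ?_ ?_ (integrable_const C) ?_).2
  · exact (hc.comp (continuous_const_add z)).aestronglyMeasurable
  · exact integrable_comp_const_add_expMeasure hr hc.measurable hB x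
  · exact (hm.comp (measurable_const_add x)).aestronglyMeasurable
  · exact Eventually.of_forall fun y z _ => hC _
  · exact Eventually.of_forall fun y z _ => HasDerivAt.comp_add_const z y (hd (z + y))

lemma abs_steinSolDeriv_le (hr : 0 < r) (hC : ∀ x, |h' x| ≤ C) (x : ℝ) :
    |steinSolDeriv r h' x| ≤ C := by
  have := isProbabilityMeasure_expMeasure hr
  rw [steinSolDeriv, abs_neg]
  exact abs_integral_le_of_abs_le (Eventually.of_forall fun y => hC _)

lemma abs_steinSol_le (hr : 0 < r) (hB : ∀ x, |h x| ≤ B) (x : ℝ) :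
    |steinSol r h x| ≤ 2 * B := by
  have := isProbabilityMeasure_expMeasure hr
  have hmean : |∫ y, h y ∂(expMeasure r)| ≤ B :=
    abs_integral_le_of_abs_le (Eventually.of_forall hB)
  have hshift : |∫ y, h (x + y) ∂(expMeasure r)| ≤ B :=
    abs_integral_le_of_abs_le (Eventually.of_forall fun y => hB _)
  exact (abs_sub _ _).trans (by linarith)

lemma abs_steinSolDeriv_sub_le (hr : 0 < r) (hC : ∀ x, |h' x| ≤ C) (hm : Measurable h')
    (hL : ∀ x y, |h' x - h' y| ≤ L * |x - y|) (x y : ℝ) :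
    |steinSolDeriv r h' x - steinSolDeriv r h' y| ≤ L * |x - y| := by
  have := isProbabilityMeasure_expMeasure hr
  rw [steinSolDeriv, steinSolDeriv, neg_sub_neg, abs_sub_comm,
    ← integral_sub (integrable_comp_const_add_expMeasure hr hm hC x)
      (integrable_comp_const_add_expMeasure hr hm hC y)]
  refine abs_integral_le_of_abs_le (Eventually.of_forall fun z => ?_)
  simpa only [add_sub_add_right_eq_sub] using hL (x + z) (y + z)

-- Integrate `(-exp (-r y) h (x + y))'` over `y > 0`.
lemma stein_equation (hr : 0 < r) (hd : ∀ x, HasDerivAt h (h' x) x) (hB : ∀ x, |h x| ≤ B)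
    (hC : ∀ x, |h' x| ≤ C) (hm : Measurable h') (x : ℝ) :
    1 / r * steinSolDeriv r h' x - steinSol r h x = h x - ∫ y, h y ∂(expMeasure r) := by
  have hc : Continuous h := continuous_iff_continuousAt.2 fun x => (hd x).continuousAt
  have hint := (integrable_expMeasure_iff hr _).1
    (integrable_comp_const_add_expMeasure hr hc.measurable hB x)
  have hint' := (integrable_expMeasure_iff hr _).1
    (integrable_comp_const_add_expMeasure hr hm hC x)
  have hderiv (y : ℝ) : HasDerivAt (fun y => -Real.exp (-(r * y)) * h (x + y))
      (r * Real.exp (-(r * y)) * h (x + y)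
        - 1 / r * (r * Real.exp (-(r * y)) * h' (x + y))) y := by
    refine (hasDerivAt_neg_exp_mul_exp.mul (HasDerivAt.comp_const_add x y (hd _))).congr_deriv ?_
    field_simp
    ring
  have hlim : Tendsto (fun y => -Real.exp (-(r * y)) * h (x + y)) atTop (𝓝 0) := by
    have hexp : Tendsto (fun y => Real.exp (-(r * y)) * B) atTop (𝓝 0) := by
      simpa using (Real.tendsto_exp_neg_atTop_nhds_zero.comp
        (tendsto_id.const_mul_atTop hr)).mul_const B
    refine squeeze_zero_norm (fun y => ?_) hexp
    rw [norm_mul, norm_neg, Real.norm_eq_abs, Real.norm_eq_abs, Real.abs_exp]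
    exact mul_le_mul_of_nonneg_left (hB _) (Real.exp_pos _).le
  have hparts := integral_Ioi_of_hasDerivAt_of_tendsto' (a := 0) (fun y _ => hderiv y)
    (hint.sub (hint'.const_mul (1 / r))) hlim
  rw [integral_sub hint (hint'.const_mul (1 / r)), integral_const_mul,
    ← integral_expMeasure hr fun y => h (x + y),
    ← integral_expMeasure hr fun y => h' (x + y)] at hparts
  simp only [mul_zero, neg_zero, Real.exp_zero, add_zero] at hparts
  rw [steinSol, steinSolDeriv]
  linarith

end Stein

/-! ### Time integrals over interarrival intervals -/

section Region

variable {Ω : Type*} {α β : Ω → ℝ}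

/-- The points `(ω, t)` with `α ω ≤ t < β ω`: Mathlib's `regionBetween` with the lower edge
included, so that the regions of consecutive interarrival intervals tile the half-line. -/
def regionIco (α β : Ω → ℝ) : Set (Ω × ℝ) := {p | p.2 ∈ Set.Ico (α p.1) (β p.1)}

lemma indicator_regionIco_apply (F : Ω × ℝ → ℝ) (ω : Ω) (t : ℝ) :
    (regionIco α β).indicator F (ω, t)
      = (Set.Ico (α ω) (β ω)).indicator (fun t => F (ω, t)) t := rfl

variable [MeasurableSpace Ω] {P : Measure Ω}

lemma measurableSet_regionIco (hα : Measurable α) (hβ : Measurable β) :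
    MeasurableSet (regionIco α β) :=
  (measurableSet_le (hα.comp measurable_fst) measurable_snd).inter
    (measurableSet_lt measurable_snd (hβ.comp measurable_fst))

lemma measure_regionIco_lt_top (hα : Measurable α) (hβ : Measurable β)
    (hi : Integrable (fun ω => β ω - α ω) P) : (P.prod volume) (regionIco α β) < ⊤ := by
  have hslice (ω : Ω) : volume (Prod.mk ω ⁻¹' regionIco α β) = ENNReal.ofReal (β ω - α ω) :=
    Real.volume_Ico (a := α ω) (b := β ω)
  rw [Measure.prod_apply (measurableSet_regionIco hα hβ)]
  simp_rw [hslice]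
  exact hi.lintegral_lt_top

variable {F : Ω × ℝ → ℝ} {B : ℝ}

lemma integrable_indicator_regionIco (hα : Measurable α) (hβ : Measurable β)
    (hi : Integrable (fun ω => β ω - α ω) P) (hF : Measurable F) (hB : ∀ p, |F p| ≤ B) :
    Integrable ((regionIco α β).indicator F) (P.prod volume) := by
  rw [integrable_indicator_iff (measurableSet_regionIco hα hβ)]
  exact IntegrableOn.of_bound (measure_regionIco_lt_top hα hβ hi) hF.aestronglyMeasurable B
    (Eventually.of_forall hB)

lemma integral_indicator_regionIco [SFinite P] (hα : Measurable α) (hβ : Measurable β)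
    (hi : Integrable (fun ω => β ω - α ω) P) (hF : Measurable F) (hB : ∀ p, |F p| ≤ B) :
    ∫ p, (regionIco α β).indicator F p ∂(P.prod volume)
      = ∫ ω, (∫ t in Set.Ico (α ω) (β ω), F (ω, t)) ∂P := by
  rw [integral_prod _ (integrable_indicator_regionIco hα hβ hi hF hB)]
  simp_rw [indicator_regionIco_apply, integral_indicator measurableSet_Ico]

end Region

section Paths

variable {Ω : Type*} {U S : ℕ → Ω → ℝ} {ω : Ω}

lemma arrivalTime_succ (n : ℕ) (ω : Ω) :
    arrivalTime U (n + 1) ω = arrivalTime U n ω + U n ω :=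
  Finset.sum_range_succ (fun i => U i ω) n

lemma monotone_arrivalTime (hU : ∀ n, 0 ≤ U n ω) : Monotone fun n => arrivalTime U n ω :=
  monotone_nat_of_le_succ fun n => by rw [arrivalTime_succ]; linarith [hU n]

lemma arrivalTime_nonneg (hU : ∀ n, 0 ≤ U n ω) (n : ℕ) : 0 ≤ arrivalTime U n ω :=
  Finset.sum_nonneg fun i _ => hU i

lemma lastArrival_eq (hU : ∀ n, 0 ≤ U n ω) {k : ℕ} {t : ℝ}
    (ht : t ∈ Set.Ico (arrivalTime U k ω) (arrivalTime U (k + 1) ω)) :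
    lastArrival U t ω = k := by
  have : {n : ℕ | arrivalTime U n ω ≤ t} = Set.Iic k := by
    ext n
    refine ⟨fun hn => ?_, fun hn => (monotone_arrivalTime hU hn).trans ht.1⟩
    by_contra hlt
    exact not_lt.2 hn (ht.2.trans_le (monotone_arrivalTime hU (not_le.1 hlt : k < n)))
  rw [lastArrival, this]
  exact csSup_Iic

/-- The function `f` of the workload during the first `n` interarrival intervals and `0` at other
times, written as a sum over the intervals in order to have joint measurability in `(ω, t)`. -/
noncomputable def workloadUntil (U S : ℕ → Ω → ℝ) (f : ℝ → ℝ) (n : ℕ) (p : Ω × ℝ) : ℝ :=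
  ∑ k ∈ Finset.range n, (regionIco (arrivalTime U k) (arrivalTime U (k + 1))).indicator
    (fun p => f (max (workAfterArrival U S p.1 k - (p.2 - arrivalTime U k p.1)) 0)) p

lemma workloadUntil_eq_indicator (hU : ∀ n, 0 ≤ U n ω) (f : ℝ → ℝ) (n : ℕ) (t : ℝ) :
    workloadUntil U S f n (ω, t)
      = (Set.Ico 0 (arrivalTime U n ω)).indicator (fun t => f (workload U S t ω)) t := by
  induction n with
  | zero => simp [workloadUntil, arrivalTime]
  | succ n ih =>
    rw [← Set.Ico_union_Ico_eq_Ico (arrivalTime_nonneg hU n)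
        (monotone_arrivalTime hU (Nat.le_succ n)),
      Set.indicator_union_of_disjoint Set.Ico_disjoint_Ico_same, workloadUntil,
      Finset.sum_range_succ, indicator_regionIco_apply]
    refine congrArg₂ (· + ·) ih ?_
    by_cases ht : t ∈ Set.Ico (arrivalTime U n ω) (arrivalTime U (n + 1) ω)
    · rw [Set.indicator_of_mem ht, Set.indicator_of_mem ht, workload, lastArrival_eq hU ht]
    · rw [Set.indicator_of_notMem ht, Set.indicator_of_notMem ht]

end Paths

namespace IsQueue

variable {Ω : Type*} [MeasurableSpace Ω] {P : Measure Ω} {U S : ℕ → Ω → ℝ}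

lemma measurable_arrivalTime (h : IsQueue P U S) (n : ℕ) : Measurable (arrivalTime U n) :=
  Finset.measurable_fun_sum _ fun i _ => h.measurable_U i

lemma measurable_workAfterArrival (h : IsQueue P U S) (n : ℕ) :
    Measurable fun ω => workAfterArrival U S ω n := by
  simp_rw [workAfterArrival_eq]
  exact (h.measurable_waitingTime n).add (h.measurable_S n)

variable [IsProbabilityMeasure P]

lemma integrable_interarrival (h : IsQueue P U S) (n : ℕ) : Integrable (U n) P :=
  h.integrable_pair n measurable_fst (h.memLp_U.integrable (by norm_num))

lemma integrable_arrivalTime (h : IsQueue P U S) (n : ℕ) : Integrable (arrivalTime U n) P :=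
  integrable_finsetSum _ fun i _ => h.integrable_interarrival i

lemma integrable_arrivalTime_succ_sub (h : IsQueue P U S) (n : ℕ) :
    Integrable (fun ω => arrivalTime U (n + 1) ω - arrivalTime U n ω) P :=
  (h.integrable_arrivalTime _).sub (h.integrable_arrivalTime _)

lemma tendsto_integral_abs_arrivalTime_sub (h : IsQueue P U S) :
    Tendsto (fun n : ℕ => (∫ ω, |arrivalTime U n ω - n * ∫ ω, U 0 ω ∂P| ∂P) / n) atTop (𝓝 0) := by
  have hLp := strong_law_Lp (p := 1) le_rfl (by norm_num) U
    (memLp_one_iff_integrable.2 (h.integrable_interarrival 0))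
    (fun i j hij => h.indep.indepFun (i := Sum.inl i) (j := Sum.inl j) (by simpa using hij))
    h.ident_U
  have hreal := (ENNReal.tendsto_toReal (by simp)).comp hLp
  rw [ENNReal.toReal_zero] at hreal
  refine hreal.congr' ?_
  filter_upwards [eventually_gt_atTop 0] with n hn
  have hn : (0 : ℝ) < n := by exact_mod_cast hn
  rw [Function.comp_apply, eLpNorm_one_eq_lintegral_enorm, ← integral_norm_eq_lintegral_enorm,
    ← integral_div]
  · refine integral_congr_ae (Eventually.of_forall fun ω => ?_)
    simp only [smul_eq_mul, Real.norm_eq_abs]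
    rw [← abs_of_pos hn, ← abs_div, abs_of_pos hn, sub_div, mul_div_cancel_left₀ _ hn.ne',
      div_eq_inv_mul]
    rfl
  · exact (((h.integrable_arrivalTime n).const_mul ((n : ℝ)⁻¹)).sub
      (integrable_const _)).aestronglyMeasurable

end IsQueue

/-! ### Ergodic averages of the workload -/

lemma abs_indicator_Ico_sub_indicator_Ico_le {F : ℝ → ℝ} {B : ℝ} (hB : ∀ t, |F t| ≤ B) {x y : ℝ}
    (hx : 0 ≤ x) (hy : 0 ≤ y) (t : ℝ) :
    |(Set.Ico 0 x).indicator F t - (Set.Ico 0 y).indicator F t|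
      ≤ (Set.Ico (min x y) (max x y)).indicator (fun _ => B) t := by
  have hFt := hB t
  simp only [Set.indicator, Set.mem_Ico, min_le_iff, lt_max_iff]
  grind

lemma abs_indicator_Ico_le {φ : ℝ → ℝ} {B ε t₀ : ℝ} (hε : 0 ≤ ε) (hB : ∀ t, |φ t| ≤ B)
    (hφ : ∀ t, t₀ ≤ t → |φ t| ≤ ε) (c t : ℝ) :
    |(Set.Ico 0 c).indicator φ t|
      ≤ (Set.Ico 0 t₀).indicator (fun _ => B) t + (Set.Ico 0 c).indicator (fun _ => ε) t := by
  have hBt := hB t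
  have hφt := hφ t
  simp only [Set.indicator, Set.mem_Ico]
  grind

lemma tendsto_integral_comp_of_tendstoInDistribution {Ω' ι : Type*} {Ωs : ι → Type*}
    [∀ i, MeasurableSpace (Ωs i)] [MeasurableSpace Ω'] {μ : ∀ i, Measure (Ωs i)}
    [∀ i, IsProbabilityMeasure (μ i)] {P' : Measure Ω'} [IsProbabilityMeasure P']
    {l : Filter ι} {Z : ∀ i, Ωs i → ℝ} {X : Ω' → ℝ} (hX : TendstoInDistribution Z l X μ P')
    {f : ℝ → ℝ} {B : ℝ} (hf : Continuous f) (hB : ∀ x, |f x| ≤ B) :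
    Tendsto (fun i => ∫ ω, f (Z i ω) ∂(μ i)) l (𝓝 (∫ ω, f (X ω) ∂P')) := by
  have := ProbabilityMeasure.tendsto_iff_forall_integral_tendsto.1 hX.tendsto
    (BoundedContinuousFunction.ofNormedAddCommGroup f hf B hB)
  simp only [ProbabilityMeasure.coe_mk, BoundedContinuousFunction.coe_ofNormedAddCommGroup,
    integral_map hX.aemeasurable_limit hf.aestronglyMeasurable] at this
  exact this.congr fun i => integral_map (hX.forall_aemeasurable i) hf.aestronglyMeasurable

/-- The times between `c` and the arrival of customer `n`, in either order. -/
def arrivalDiscrepancy {Ω : Type*} (U : ℕ → Ω → ℝ) (n : ℕ) (c : ℝ) : Set (Ω × ℝ) :=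
  regionIco (fun ω => min (arrivalTime U n ω) c) fun ω => max (arrivalTime U n ω) c

lemma tendsto_div_natCast_of_abs_sub_le {u r : ℕ → ℝ} {l : ℝ}
    (hr : Tendsto (fun n => r n / n) atTop (𝓝 0))
    (hu : ∀ ε > 0, ∃ C, ∀ n, |u n - n * l| ≤ C + ε * n + r n) :
    Tendsto (fun n => u n / n) atTop (𝓝 l) := by
  rw [Metric.tendsto_atTop]
  intro e he
  obtain ⟨C, hC⟩ := hu (e / 2) (half_pos he)
  have hsmall := (tendsto_const_div_atTop_nhds_zero_nat C).add hr
  rw [add_zero] at hsmall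
  obtain ⟨N, hN⟩ := eventually_atTop.1 (hsmall.eventually_lt_const (half_pos he))
  refine ⟨max N 1, fun n hn => ?_⟩
  have hn₀ : (0 : ℝ) < n := by exact_mod_cast (le_max_right N 1).trans hn
  calc |u n / n - l| = |u n - n * l| / n := by
        rw [← abs_of_pos hn₀, ← abs_div, abs_of_pos hn₀, sub_div, mul_div_cancel_left₀ _ hn₀.ne']
    _ ≤ (C + e / 2 * n + r n) / n := div_le_div_of_nonneg_right (hC n) hn₀.le
    _ = C / n + r n / n + e / 2 := by
        field_simp
        ring
    _ < e / 2 + e / 2 := add_lt_add_left (hN n ((le_max_left N 1).trans hn)) _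
    _ = e := add_halves e

namespace IsQueue

variable {Ω : Type*} [MeasurableSpace Ω] {P : Measure Ω} {U S : ℕ → Ω → ℝ} {f : ℝ → ℝ} {B : ℝ}

lemma measurable_comp_work (h : IsQueue P U S) (hf : Measurable f) (k : ℕ) :
    Measurable fun p : Ω × ℝ =>
      f (max (workAfterArrival U S p.1 k - (p.2 - arrivalTime U k p.1)) 0) := by
  have hQ := h.measurable_workAfterArrival k
  have hT := h.measurable_arrivalTime k
  fun_prop

variable [IsProbabilityMeasure P]

lemma integrable_workloadUntil (h : IsQueue P U S) (hf : Measurable f) (hB : ∀ x, |f x| ≤ B)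
    (n : ℕ) : Integrable (workloadUntil U S f n) (P.prod volume) :=
  integrable_finsetSum _ fun k _ => integrable_indicator_regionIco (h.measurable_arrivalTime k)
    (h.measurable_arrivalTime (k + 1)) (h.integrable_arrivalTime_succ_sub k)
    (h.measurable_comp_work hf k) fun _ => hB _

lemma sum_integral_workload_eq (h : IsQueue P U S) (hf : Measurable f) (hB : ∀ x, |f x| ≤ B)
    (n : ℕ) :
    ∑ k ∈ Finset.range n, ∫ ω, (∫ r in 0..U k ω, f (max (workAfterArrival U S ω k - r) 0)) ∂P
      = ∫ t, ∫ ω, workloadUntil U S f n (ω, t) ∂P := by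
  have hT := h.measurable_arrivalTime
  have hi := h.integrable_arrivalTime_succ_sub
  have hF := h.measurable_comp_work hf
  have hterm (k : ℕ) :
      ∫ ω, (∫ r in 0..U k ω, f (max (workAfterArrival U S ω k - r) 0)) ∂P
        = ∫ p, (regionIco (arrivalTime U k) (arrivalTime U (k + 1))).indicator
          (fun p => f (max (workAfterArrival U S p.1 k - (p.2 - arrivalTime U k p.1)) 0)) p
          ∂(P.prod volume) := by
    rw [integral_indicator_regionIco (hT k) (hT (k + 1)) (hi k) (hF k) fun _ => hB _]
    refine integral_congr_ae ?_
    filter_upwards [h.nonneg_U k] with ω hω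
    rw [integral_Ico_eq_integral_Ioc, arrivalTime_succ,
      ← intervalIntegral.integral_of_le (le_add_of_nonneg_right hω)]
    simp [intervalIntegral.integral_comp_sub_right
      (fun r => f (max (workAfterArrival U S ω k - r) 0))]
  rw [← integral_prod_symm _ (h.integrable_workloadUntil hf hB n)]
  simp_rw [hterm, workloadUntil]
  exact (integral_finsetSum _ fun k _ => integrable_indicator_regionIco (hT k) (hT (k + 1))
    (hi k) (hF k) fun _ => hB _).symm

lemma integrable_max_sub_min_arrivalTime (h : IsQueue P U S) (n : ℕ) (c : ℝ) :
    Integrable (fun ω => max (arrivalTime U n ω) c - min (arrivalTime U n ω) c) P := by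
  simp_rw [max_sub_min_eq_abs']
  exact ((h.integrable_arrivalTime n).sub (integrable_const _)).abs

lemma integrable_indicator_arrivalDiscrepancy (h : IsQueue P U S) (n : ℕ) (B c : ℝ) :
    Integrable ((arrivalDiscrepancy U n c).indicator fun _ => B) (P.prod volume) :=
  integrable_indicator_regionIco ((h.measurable_arrivalTime n).min measurable_const)
    ((h.measurable_arrivalTime n).max measurable_const) (h.integrable_max_sub_min_arrivalTime n c)
    measurable_const fun _ => le_rfl

lemma integral_indicator_arrivalDiscrepancy (h : IsQueue P U S) (n : ℕ) (B c : ℝ) :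
    ∫ t, ∫ ω, (arrivalDiscrepancy U n c).indicator (fun _ => B) (ω, t) ∂P
      = B * ∫ ω, |arrivalTime U n ω - c| ∂P := by
  rw [← integral_prod_symm _ (h.integrable_indicator_arrivalDiscrepancy n B c),
    arrivalDiscrepancy, integral_indicator_regionIco
    ((h.measurable_arrivalTime n).min measurable_const)
    ((h.measurable_arrivalTime n).max measurable_const) (h.integrable_max_sub_min_arrivalTime n c)
    measurable_const fun _ => le_rfl, ← integral_const_mul]
  congr with ω
  rw [setIntegral_const, Real.volume_real_Ico_of_le min_le_max, max_sub_min_eq_abs', smul_eq_mul,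
    mul_comm]

lemma abs_integral_workloadUntil_sub_le (h : IsQueue P U S) (hf : Measurable f)
    (hB : ∀ x, |f x| ≤ B) (hV : ∀ t, AEMeasurable (fun ω => f (workload U S t ω)) P) (n : ℕ)
    {c : ℝ} (hc : 0 ≤ c) :
    ∀ᵐ t, |∫ ω, workloadUntil U S f n (ω, t) ∂P
        - (Set.Ico 0 c).indicator (fun t => ∫ ω, f (workload U S t ω) ∂P) t|
      ≤ ∫ ω, (arrivalDiscrepancy U n c).indicator (fun _ => B) (ω, t) ∂P := by
  filter_upwards [(h.integrable_workloadUntil hf hB n).prod_left_ae,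
    (h.integrable_indicator_arrivalDiscrepancy n B c).prod_left_ae] with t hZ hD
  have hV' : Integrable (fun ω => (Set.Ico 0 c).indicator (fun t => f (workload U S t ω)) t) P := by
    simp only [Set.indicator]
    split_ifs
    · exact .of_bound (hV t).aestronglyMeasurable B (Eventually.of_forall fun ω => hB _)
    · exact integrable_zero _ _ _
  have hswap : (Set.Ico 0 c).indicator (fun t => ∫ ω, f (workload U S t ω) ∂P) t
      = ∫ ω, (Set.Ico 0 c).indicator (fun t => f (workload U S t ω)) t ∂P := by
    simp only [Set.indicator]
    split_ifs <;> simp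
  rw [hswap, ← integral_sub hZ hV', ← Real.norm_eq_abs]
  refine norm_integral_le_of_norm_le hD ?_
  filter_upwards [ae_all_iff.2 h.nonneg_U] with ω hω
  rw [workloadUntil_eq_indicator hω]
  exact abs_indicator_Ico_sub_indicator_Ico_le (fun t => hB _) (arrivalTime_nonneg hω n) hc t

lemma abs_sum_integral_workload_sub_le (h : IsQueue P U S) (hf : Measurable f)
    (hB : ∀ x, |f x| ≤ B) (hV : ∀ t, AEMeasurable (fun ω => f (workload U S t ω)) P)
    {m ε t₀ : ℝ} (hm : |m| ≤ B) (hε : 0 ≤ ε) (ht₀ : 0 ≤ t₀)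
    (hφ : ∀ t, t₀ ≤ t → |∫ ω, f (workload U S t ω) ∂P - m| ≤ ε) (n : ℕ) {c : ℝ} (hc : 0 ≤ c) :
    |∑ k ∈ Finset.range n, ∫ ω, (∫ r in 0..U k ω, f (max (workAfterArrival U S ω k - r) 0)) ∂P
        - c * m|
      ≤ 2 * B * t₀ + ε * c + B * ∫ ω, |arrivalTime U n ω - c| ∂P := by
  have hind (b x : ℝ) : Integrable ((Set.Ico 0 x).indicator fun _ => b) (volume : Measure ℝ) :=
    (integrable_indicator_iff measurableSet_Ico).2 (integrableOn_const measure_Ico_lt_top.ne)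
  have hval (b : ℝ) {x : ℝ} (hx : 0 ≤ x) : ∫ t, (Set.Ico 0 x).indicator (fun _ => b) t = b * x := by
    rw [integral_indicator_const _ measurableSet_Ico, Real.volume_real_Ico_of_le hx, sub_zero,
      smul_eq_mul, mul_comm]
  have hZ := (h.integrable_workloadUntil hf hB n).integral_prod_right
  have hD := (h.integrable_indicator_arrivalDiscrepancy n B c).integral_prod_right
  have hcentered (t : ℝ) : |∫ ω, f (workload U S t ω) ∂P - m| ≤ 2 * B := by
    have := abs_integral_le_of_abs_le (μ := P) (Eventually.of_forall fun ω => hB (workload U S t ω))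
    exact (abs_sub _ _).trans (by linarith)
  have hdet : Integrable (fun t => (Set.Ico 0 t₀).indicator (fun _ => 2 * B) t
      + (Set.Ico 0 c).indicator (fun _ => ε) t) (volume : Measure ℝ) :=
    (hind (2 * B) t₀).add (hind ε c)
  calc _ = |∫ t, (∫ ω, workloadUntil U S f n (ω, t) ∂P
          - (Set.Ico 0 c).indicator (fun _ => m) t)| := by
        rw [h.sum_integral_workload_eq hf hB, integral_sub hZ (hind m c), hval m hc, mul_comm]
    _ ≤ ∫ t, ((Set.Ico 0 t₀).indicator (fun _ => 2 * B) t + (Set.Ico 0 c).indicator (fun _ => ε) t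
          + ∫ ω, (arrivalDiscrepancy U n c).indicator (fun _ => B) (ω, t) ∂P) := by
        rw [← Real.norm_eq_abs]
        refine norm_integral_le_of_norm_le (hdet.add hD) ?_
        filter_upwards [h.abs_integral_workloadUntil_sub_le hf hB hV n hc] with t ht
        have hsplit := abs_indicator_Ico_le hε hcentered hφ c t
        rw [Real.norm_eq_abs]
        simp only [Set.indicator_apply] at *
        grind
    _ = _ := by
        rw [integral_add hdet hD, integral_add (hind _ _) (hind _ _),
          hval _ ht₀, hval _ hc, h.integral_indicator_arrivalDiscrepancy]

lemma tendsto_average_workload (h : IsQueue P U S) {Ω' : Type*} [MeasurableSpace Ω']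
    {P' : Measure Ω'} [IsProbabilityMeasure P'] {X : Ω' → ℝ}
    (hX : TendstoInDistribution (scaledWorkload U S P) atTop X (fun _ : ℝ => P) P')
    (hf : Continuous f) (hB : ∀ x, |f x| ≤ B) :
    Tendsto (fun n : ℕ => (∑ k ∈ Finset.range n, ∫ ω, (∫ r in 0..U k ω,
        f ((1 - utilization U S P) * max (workAfterArrival U S ω k - r) 0)) ∂P) / n)
      atTop (𝓝 ((∫ ω, U 0 ω ∂P) * ∫ ω, f (X ω) ∂P')) := by
  have ha : 0 ≤ ∫ ω, U 0 ω ∂P := integral_nonneg_of_ae (h.nonneg_U 0)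
  have hm : |∫ ω, f (X ω) ∂P'| ≤ B := abs_integral_le_of_abs_le (Eventually.of_forall fun ω => hB _)
  have hr := h.tendsto_integral_abs_arrivalTime_sub.const_mul B
  simp only [mul_zero, ← mul_div_assoc] at hr
  refine tendsto_div_natCast_of_abs_sub_le hr fun ε hε => ?_
  have hε' : 0 < ε / (∫ ω, U 0 ω ∂P + 1) := by positivity
  have hεa : ε / (∫ ω, U 0 ω ∂P + 1) * ∫ ω, U 0 ω ∂P ≤ ε := by
    rw [div_mul_eq_mul_div, div_le_iff₀ (by positivity)]
    gcongr
    exact le_add_of_nonneg_right zero_le_one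
  obtain ⟨t₁, ht₁⟩ := Metric.tendsto_atTop.1
    (tendsto_integral_comp_of_tendstoInDistribution hX hf hB) _ hε'
  refine ⟨2 * B * max t₁ 0, fun n => ?_⟩
  have hbound := h.abs_sum_integral_workload_sub_le
    (hf.measurable.comp (measurable_const_mul (1 - utilization U S P))) (fun x => hB _)
    (fun t => hf.measurable.comp_aemeasurable (hX.forall_aemeasurable t)) hm hε'.le
    (le_max_right t₁ 0) (fun t ht => (ht₁ t ((le_max_left _ _).trans ht)).le) n
    (c := n * ∫ ω, U 0 ω ∂P) (by positivity)
  rw [mul_assoc (n : ℝ)] at hbound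
  refine hbound.trans (add_le_add_left (add_le_add_right ?_ _) _)
  rw [mul_left_comm, mul_comm]
  exact mul_le_mul_of_nonneg_right hεa n.cast_nonneg

end IsQueue

/-! ### Expansions along the Lindley chain -/

section Taylor

variable {F F' : ℝ → ℝ}

lemma abs_sub_le_of_abs_deriv_le (hF : ∀ s, HasDerivAt F (F' s) s) {a K : ℝ}
    (hK : ∀ s, |s| ≤ |a| → |F' s| ≤ K) : |F a - F 0| ≤ K * |a| := by
  have h := (convex_uIcc 0 a).norm_image_sub_le_of_norm_hasDerivWithin_le (C := K)
    (f := F) (f' := F') (fun s _ => (hF s).hasDerivWithinAt)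
    (fun s hs => hK s (by simpa using Set.abs_sub_left_of_mem_uIcc hs))
    Set.left_mem_uIcc Set.right_mem_uIcc
  simpa using h

lemma abs_sub_sub_mul_deriv_le (hF : ∀ s, HasDerivAt F (F' s) s) {x M : ℝ}
    (hM : ∀ s, |F' (x + s) - F' x| ≤ M * |s|) (a : ℝ) :
    |F (x + a) - F x - a * F' x| ≤ M * a ^ 2 := by
  have hM₀ : 0 ≤ M := by simpa using (abs_nonneg _).trans (hM 1)
  have hderiv (s : ℝ) : HasDerivAt (fun s => F (x + s) - s * F' x) (F' (x + s) - F' x) s :=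
    (((hF (x + s)).comp_const_add x s).sub ((hasDerivAt_id s).mul_const (F' x))).congr_deriv
      (by rw [one_mul])
  have h := abs_sub_le_of_abs_deriv_le hderiv (a := a) (K := M * |a|)
    fun s hs => (hM s).trans (mul_le_mul_of_nonneg_left hs hM₀)
  rw [mul_assoc, abs_mul_abs_self, ← sq] at h
  convert h using 2
  simp only [add_zero, zero_mul, sub_zero]
  ring

end Taylor

section TestFunction

variable {γ γ₁ : ℝ → ℝ} {L B δ c : ℝ}

/-- The solutions of Stein's equation to which the argument applies: `γ` is bounded by `B`,
vanishes at `0` and has the derivative `γ₁`, which is bounded by `1` and `L`-Lipschitz. -/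
structure IsTestFunction (γ γ₁ : ℝ → ℝ) (L B : ℝ) : Prop where
  hasDerivAt : ∀ x, HasDerivAt γ (γ₁ x) x
  abs_deriv_le : ∀ x, |γ₁ x| ≤ 1
  abs_deriv_sub_le : ∀ x y, |γ₁ x - γ₁ y| ≤ L * |x - y|
  abs_le : ∀ x, |γ x| ≤ B
  zero : γ 0 = 0

/-- The Stein operator `γ ↦ c γ' - γ` of the exponential distribution with mean `c`, evaluated at a
function `γ` with derivative `γ₁`. -/
def steinOperator (c : ℝ) (γ γ₁ : ℝ → ℝ) (x : ℝ) : ℝ := c * γ₁ x - γ x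

/-- The primitive `Γ` of `v ↦ γ (δ v)` that vanishes at `0`, the Lyapunov function to which the
recursion of the waiting times is applied. -/
noncomputable def scaledPrimitive (γ : ℝ → ℝ) (δ v : ℝ) : ℝ := ∫ x in 0..v, γ (δ * x)

/-- A primitive of `v ↦ c γ'(δ v) - γ (δ v)`, which measures the integral of the scaled Stein
operator along a path on which the workload `v` decreases at unit rate. -/
noncomputable def depletionPrimitive (c : ℝ) (γ : ℝ → ℝ) (δ v : ℝ) : ℝ :=
  c / δ * γ (δ * v) - scaledPrimitive γ δ v

namespace IsTestFunction

lemma continuous (hγ : IsTestFunction γ γ₁ L B) : Continuous γ :=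
  continuous_iff_continuousAt.2 fun x => (hγ.hasDerivAt x).continuousAt

lemma continuous_deriv (hγ : IsTestFunction γ γ₁ L B) : Continuous γ₁ := by
  refine (LipschitzWith.of_dist_le_mul (K := L.toNNReal) fun x y => ?_).continuous
  rw [Real.dist_eq, Real.dist_eq]
  exact (hγ.abs_deriv_sub_le x y).trans
    (mul_le_mul_of_nonneg_right (Real.le_coe_toNNReal L) (abs_nonneg _))

lemma lipschitz_const_nonneg (hγ : IsTestFunction γ γ₁ L B) : 0 ≤ L := by
  simpa using (abs_nonneg _).trans (hγ.abs_deriv_sub_le 1 0)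

lemma abs_sub_le (hγ : IsTestFunction γ γ₁ L B) (x a : ℝ) : |γ (x + a) - γ x| ≤ |a| := by
  simpa using abs_sub_le_of_abs_deriv_le (F := fun s => γ (x + s)) (a := a) (K := 1)
    (fun s => (hγ.hasDerivAt (x + s)).comp_const_add x s) fun s _ => hγ.abs_deriv_le _

lemma abs_deriv_add_sub_le (hγ : IsTestFunction γ γ₁ L B) (x s : ℝ) :
    |γ₁ (x + s) - γ₁ x| ≤ L * |s| := by
  simpa using hγ.abs_deriv_sub_le (x + s) x

lemma abs_taylor_le (hγ : IsTestFunction γ γ₁ L B) (x a : ℝ) :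
    |γ (x + a) - γ x - a * γ₁ x| ≤ L * a ^ 2 :=
  abs_sub_sub_mul_deriv_le hγ.hasDerivAt (hγ.abs_deriv_add_sub_le x) a

section SteinOperator

lemma continuous_steinOperator (hγ : IsTestFunction γ γ₁ L B) :
    Continuous (steinOperator c γ γ₁) :=
  (hγ.continuous_deriv.const_mul c).sub hγ.continuous

lemma steinOperator_zero (hγ : IsTestFunction γ γ₁ L B) :
    steinOperator c γ γ₁ 0 = c * γ₁ 0 := by
  rw [steinOperator, hγ.zero, sub_zero]

lemma abs_steinOperator_zero_le (hγ : IsTestFunction γ γ₁ L B) (hc : 0 ≤ c) :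
    |steinOperator c γ γ₁ 0| ≤ c := by
  rw [hγ.steinOperator_zero, abs_mul, abs_of_nonneg hc]
  exact mul_le_of_le_one_right hc (hγ.abs_deriv_le 0)

lemma abs_steinOperator_le (hγ : IsTestFunction γ γ₁ L B) (hc : 0 ≤ c) (x : ℝ) :
    |steinOperator c γ γ₁ x| ≤ c + B := by
  refine (abs_sub _ _).trans (add_le_add ?_ (hγ.abs_le _))
  rw [abs_mul, abs_of_nonneg hc]
  exact mul_le_of_le_one_right hc (hγ.abs_deriv_le _)

lemma abs_steinOperator_sub_le (hγ : IsTestFunction γ γ₁ L B) (hc : 0 ≤ c) (x s : ℝ) :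
    |steinOperator c γ γ₁ (x + s) - steinOperator c γ γ₁ x| ≤ (c * L + 1) * |s| :=
  calc |steinOperator c γ γ₁ (x + s) - steinOperator c γ γ₁ x|
      = |c * (γ₁ (x + s) - γ₁ x) - (γ (x + s) - γ x)| := by
        simp only [steinOperator]
        ring_nf
    _ ≤ c * |γ₁ (x + s) - γ₁ x| + |γ (x + s) - γ x| := by
        refine (abs_sub _ _).trans_eq ?_
        rw [abs_mul, abs_of_nonneg hc]
    _ ≤ c * (L * |s|) + |s| := by
        exact add_le_add (mul_le_mul_of_nonneg_left (hγ.abs_deriv_add_sub_le x s) hc)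
          (hγ.abs_sub_le x s)
    _ = (c * L + 1) * |s| := by ring

end SteinOperator

section ScaledPrimitive

lemma hasDerivAt_scaledPrimitive (hγ : IsTestFunction γ γ₁ L B) (δ v : ℝ) :
    HasDerivAt (scaledPrimitive γ δ) (γ (δ * v)) v :=
  ((hγ.continuous.comp (continuous_const_mul δ)).integral_hasStrictDerivAt 0 v).hasDerivAt

lemma continuous_scaledPrimitive (hγ : IsTestFunction γ γ₁ L B) (δ : ℝ) :
    Continuous (scaledPrimitive γ δ) :=
  continuous_iff_continuousAt.2 fun v => (hγ.hasDerivAt_scaledPrimitive δ v).continuousAt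

lemma abs_scaledPrimitive_le (hγ : IsTestFunction γ γ₁ L B) (δ v : ℝ) :
    |scaledPrimitive γ δ v| ≤ B * |v| := by
  simpa [scaledPrimitive] using intervalIntegral.norm_integral_le_of_norm_le_const (a := 0) (b := v)
    (f := fun x => γ (δ * x)) (C := B) fun r _ => hγ.abs_le _

lemma abs_scaledPrimitive_sub_le (hγ : IsTestFunction γ γ₁ L B) (hδ : 0 ≤ δ) (v a : ℝ) :
    |scaledPrimitive γ δ (v + a) - scaledPrimitive γ δ v - a * γ (δ * v)| ≤ δ * a ^ 2 := by
  refine abs_sub_sub_mul_deriv_le (hγ.hasDerivAt_scaledPrimitive δ) (fun s => ?_) a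
  simpa only [mul_add, abs_mul, abs_of_nonneg hδ] using hγ.abs_sub_le (δ * v) (δ * s)

lemma abs_scaledPrimitive_taylor_le (hγ : IsTestFunction γ γ₁ L B) (v a : ℝ) :
    |scaledPrimitive γ δ (v + a) - scaledPrimitive γ δ v - a * γ (δ * v)
        - a ^ 2 / 2 * (δ * γ₁ (δ * v))| ≤ L * δ ^ 2 * |a| ^ 3 := by
  have hderiv (s : ℝ) : HasDerivAt
      (fun s => scaledPrimitive γ δ (v + s) - s * γ (δ * v) - s ^ 2 / 2 * (δ * γ₁ (δ * v)))
      (γ (δ * v + δ * s) - γ (δ * v) - δ * s * γ₁ (δ * v)) s := by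
    refine (((((hγ.hasDerivAt_scaledPrimitive δ (v + s)).comp_const_add v s)).sub
      ((hasDerivAt_id s).mul_const _)).sub
      (((hasDerivAt_pow 2 s).div_const 2).mul_const _)).congr_deriv ?_
    simp only [mul_add]
    ring
  have h := abs_sub_le_of_abs_deriv_le hderiv (a := a) (K := L * (δ * |a|) ^ 2) fun s hs => by
    refine (hγ.abs_taylor_le (δ * v) (δ * s)).trans ?_
    have := hγ.lipschitz_const_nonneg
    rw [mul_pow, mul_pow, ← sq_abs s]
    gcongr
  convert h using 1
  · simp only [add_zero, zero_mul, sub_zero, ne_eq, OfNat.ofNat_ne_zero, not_false_eq_true,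
      zero_pow, zero_div]
    ring_nf
  · ring

end ScaledPrimitive

section DepletionPrimitive

lemma hasDerivAt_depletionPrimitive (hγ : IsTestFunction γ γ₁ L B) (hδ : δ ≠ 0) (v : ℝ) :
    HasDerivAt (depletionPrimitive c γ δ) (steinOperator c γ γ₁ (δ * v)) v := by
  refine ((((hγ.hasDerivAt (δ * v)).comp v ((hasDerivAt_id v).const_mul δ)).const_mul
    (c / δ)).sub (hγ.hasDerivAt_scaledPrimitive δ v)).congr_deriv ?_
  simp only [mul_one, steinOperator]
  field_simp

lemma continuous_depletionPrimitive (hγ : IsTestFunction γ γ₁ L B) :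
    Continuous (depletionPrimitive c γ δ) :=
  ((hγ.continuous.comp (continuous_const_mul δ)).const_mul _).sub
    (hγ.continuous_scaledPrimitive δ)

lemma depletionPrimitive_zero (hγ : IsTestFunction γ γ₁ L B) :
    depletionPrimitive c γ δ 0 = 0 := by
  simp [depletionPrimitive, scaledPrimitive, hγ.zero]

lemma abs_depletionPrimitive_le (hγ : IsTestFunction γ γ₁ L B) (hδ : 0 ≤ δ) (hc : 0 ≤ c) (v : ℝ) :
    |depletionPrimitive c γ δ v| ≤ c / δ * B + B * |v| := by
  refine (abs_sub _ _).trans (add_le_add ?_ (hγ.abs_scaledPrimitive_le δ v))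
  rw [abs_mul, abs_of_nonneg (div_nonneg hc hδ)]
  exact mul_le_mul_of_nonneg_left (hγ.abs_le _) (div_nonneg hc hδ)

lemma abs_depletionPrimitive_sub_le (hγ : IsTestFunction γ γ₁ L B) (hδ : 0 < δ) (hc : 0 ≤ c)
    (v a : ℝ) :
    |depletionPrimitive c γ δ (v + a) - depletionPrimitive c γ δ v
        - a * steinOperator c γ γ₁ (δ * v)| ≤ δ * (c * L + 1) * a ^ 2 := by
  refine abs_sub_sub_mul_deriv_le (hγ.hasDerivAt_depletionPrimitive hδ.ne') (fun s => ?_) a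
  refine (mul_add δ v s ▸ hγ.abs_steinOperator_sub_le hc (δ * v) (δ * s)).trans_eq ?_
  rw [abs_mul, abs_of_pos hδ]
  ring

lemma integral_steinOperator_depletion (hγ : IsTestFunction γ γ₁ L B) (hδ : δ ≠ 0) {q : ℝ}
    (hq : 0 ≤ q) (u : ℝ) :
    ∫ r in 0..u, steinOperator c γ γ₁ (δ * max (q - r) 0)
      = depletionPrimitive c γ δ q - depletionPrimitive c γ δ (max (q - u) 0)
        + max (u - q) 0 * steinOperator c γ γ₁ 0 := by
  set f := steinOperator c γ γ₁
  have hf : Continuous f := hγ.continuous_steinOperator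
  have hcont : Continuous fun x => f (δ * max x 0) := by fun_prop
  have hbusy : ∫ x in max (q - u) 0..q, f (δ * max x 0)
      = depletionPrimitive c γ δ q - depletionPrimitive c γ δ (max (q - u) 0) := by
    have hpos : ∀ x ∈ Set.uIcc (max (q - u) 0) q, 0 ≤ x := fun x hx =>
      (le_min (le_max_right _ _) hq).trans hx.1
    rw [intervalIntegral.integral_congr (g := fun x => f (δ * x))
      fun x hx => by simp only [max_eq_left (hpos x hx)]]
    exact intervalIntegral.integral_eq_sub_of_hasDerivAt
      (fun x _ => hγ.hasDerivAt_depletionPrimitive hδ x)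
      (Continuous.intervalIntegrable (by fun_prop) _ _)
  have hidle : ∫ x in q - u..max (q - u) 0, f (δ * max x 0) = max (u - q) 0 * f 0 := by
    rcases le_total (q - u) 0 with h | h
    · rw [max_eq_right h, max_eq_left (by linarith),
        intervalIntegral.integral_congr (g := fun _ => f 0) fun x hx => ?_]
      · simp
      · rw [Set.uIcc_of_le h] at hx
        simp [max_eq_right hx.2]
    · rw [max_eq_left h, max_eq_right (by linarith), intervalIntegral.integral_same, zero_mul]
  rw [intervalIntegral.integral_comp_sub_left (fun x => f (δ * max x 0)) q, sub_zero,
    ← intervalIntegral.integral_add_adjacent_intervals (hcont.intervalIntegrable _ _)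
      (hcont.intervalIntegrable _ _), hidle, hbusy, add_comm]

end DepletionPrimitive

end IsTestFunction

end TestFunction

lemma abs_sub_sub_sum_le {x y e : ℕ → ℝ} (h : ∀ k, |x (k + 1) - x k - y k| ≤ e k) (n : ℕ) :
    |x n - x 0 - ∑ k ∈ Finset.range n, y k| ≤ ∑ k ∈ Finset.range n, e k := by
  rw [← Finset.sum_range_sub, ← Finset.sum_sub_distrib]
  exact (Finset.abs_sum_le_sum_abs _ _).trans (Finset.sum_le_sum fun k _ => h k)

lemma abs_integral_le_integral_of_abs_le {α : Type*} [MeasurableSpace α] {μ : Measure α}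
    {f F : α → ℝ} (hf : ∀ x, |f x| ≤ F x) (hF : Integrable F μ) :
    |∫ x, f x ∂μ| ≤ ∫ x, F x ∂μ :=
  norm_integral_le_of_norm_le (f := f) hF (Eventually.of_forall hf)

section Step

variable {Ω : Type*} {U S : ℕ → Ω → ℝ} {γ γ₁ : ℝ → ℝ} {L B δ : ℝ}

lemma IsTestFunction.abs_scaledPrimitive_waitingTime_sub_le (hγ : IsTestFunction γ γ₁ L B)
    (hδ : 0 ≤ δ) (k : ℕ) (ω : Ω) :
    |scaledPrimitive γ δ (waitingTime U S (k + 1) ω) - scaledPrimitive γ δ (waitingTime U S k ω)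
        - (S k ω - U k ω) * γ (δ * waitingTime U S k ω)
        - (S k ω - U k ω) ^ 2 / 2 * (δ * γ₁ (δ * waitingTime U S k ω))|
      ≤ δ * idleTime U S k ω ^ 2 + L * δ ^ 2 * |S k ω - U k ω| ^ 3 := by
  set w := waitingTime U S k ω
  set x := S k ω - U k ω
  have hreflect : |scaledPrimitive γ δ (waitingTime U S (k + 1) ω) - scaledPrimitive γ δ (w + x)|
      ≤ δ * idleTime U S k ω ^ 2 := by
    rw [waitingTime_succ, idleTime]
    rcases le_total (w + x) 0 with hx | hx
    · have h := hγ.abs_scaledPrimitive_sub_le hδ 0 (w + x)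
      rw [mul_zero, hγ.zero, mul_zero, sub_zero, zero_add, abs_sub_comm] at h
      rw [max_eq_right hx, max_eq_left (by linarith)]
      exact h.trans_eq (by ring)
    · rw [max_eq_left hx, sub_self, abs_zero]
      positivity
  have htaylor := hγ.abs_scaledPrimitive_taylor_le (δ := δ) w x
  refine le_of_eq_of_le ?_ ((abs_add_le _ _).trans (add_le_add hreflect htaylor))
  congr 1
  ring

end Step

namespace IsQueue

variable {Ω : Type*} [MeasurableSpace Ω] {P : Measure Ω} [IsProbabilityMeasure P]
  {U S : ℕ → Ω → ℝ} {γ γ₁ : ℝ → ℝ} {L B δ c : ℝ}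

lemma integrable_idleTime_sq (h : IsQueue P U S) (k : ℕ) :
    Integrable (fun ω => idleTime U S k ω ^ 2) P := by
  refine (h.integrable_pair k (ψ := fun p => p.1 ^ 2) (by fun_prop)
    (h.integrable_U_pow (by norm_num : 2 ≤ 3))).mono'
    ((h.measurable_idleTime k).pow_const 2).aestronglyMeasurable ?_
  filter_upwards [h.nonneg_pair k] with ω hω
  rw [Real.norm_eq_abs, abs_of_nonneg (sq_nonneg _)]
  refine pow_le_pow_left₀ (idleTime_nonneg k ω) (max_le ?_ hω.1) 2
  linarith [hω.2, waitingTime_nonneg (U := U) (S := S) k ω]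

lemma integrable_abs_sub_pow_three (h : IsQueue P U S) :
    Integrable (fun ω => |S 0 ω - U 0 ω| ^ 3) P := by
  have hnorm := MemLp.integrable_norm_pow' (p := 3) (by exact_mod_cast h.memLp_sub)
  simpa only [Real.norm_eq_abs] using hnorm

lemma integrable_comp_waitingTime (h : IsQueue P U S) {φ : ℝ → ℝ} (hφ : Measurable φ) {D E : ℝ}
    (hb : ∀ x, |φ x| ≤ D + E * |x|) (k : ℕ) : Integrable (fun ω => φ (waitingTime U S k ω)) P :=
  ((integrable_const D).add ((h.integrable_waitingTime k).abs.const_mul E)).mono'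
    (hφ.comp (h.measurable_waitingTime k)).aestronglyMeasurable
    (Eventually.of_forall fun _ => hb _)

lemma abs_integral_comp_waitingTime_le (h : IsQueue P U S) {φ : ℝ → ℝ} {D E : ℝ}
    (hb : ∀ x, |φ x| ≤ D + E * |x|) (k : ℕ) :
    |∫ ω, φ (waitingTime U S k ω) ∂P| ≤ D + E * ∫ ω, waitingTime U S k ω ∂P := by
  have hW := (h.integrable_waitingTime k).const_mul E
  have hbW (ω : Ω) : |φ (waitingTime U S k ω)| ≤ D + E * waitingTime U S k ω := by
    simpa only [abs_of_nonneg (waitingTime_nonneg k ω)] using hb (waitingTime U S k ω)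
  refine (abs_integral_le_integral_of_abs_le hbW ((integrable_const D).add hW)).trans_eq ?_
  rw [integral_add (integrable_const D) hW, integral_const, probReal_univ, one_smul,
    integral_const_mul]

section TestFunction

variable (h : IsQueue P U S) (hγ : IsTestFunction γ γ₁ L B)
include h hγ

lemma integrable_testFunction_waitingTime (k : ℕ) :
    Integrable (fun ω => γ (δ * waitingTime U S k ω)) P := by
  have := hγ.continuous
  exact h.integrable_comp_waitingTime (φ := fun x => γ (δ * x)) (by fun_prop) (D := B) (E := 0)
    (fun x => by simpa using hγ.abs_le _) k

lemma integrable_testFunction_deriv_waitingTime (k : ℕ) :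
    Integrable (fun ω => γ₁ (δ * waitingTime U S k ω)) P := by
  have := hγ.continuous_deriv
  exact h.integrable_comp_waitingTime (φ := fun x => γ₁ (δ * x)) (by fun_prop) (D := 1) (E := 0)
    (fun x => by simpa using hγ.abs_deriv_le _) k

lemma integral_steinOperator_waitingTime (k : ℕ) :
    ∫ ω, steinOperator c γ γ₁ (δ * waitingTime U S k ω) ∂P
      = c * ∫ ω, γ₁ (δ * waitingTime U S k ω) ∂P - ∫ ω, γ (δ * waitingTime U S k ω) ∂P := by
  simp only [steinOperator]
  rw [integral_sub ((h.integrable_testFunction_deriv_waitingTime hγ k).const_mul c)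
    (h.integrable_testFunction_waitingTime hγ k), integral_const_mul]

lemma integrable_scaledPrimitive_waitingTime (k : ℕ) :
    Integrable (fun ω => scaledPrimitive γ δ (waitingTime U S k ω)) P :=
  h.integrable_comp_waitingTime (hγ.continuous_scaledPrimitive δ).measurable (D := 0)
    (fun x => by simpa using hγ.abs_scaledPrimitive_le δ x) k

end TestFunction

lemma integral_increment_mul_testFunction (h : IsQueue P U S) (hγ : IsTestFunction γ γ₁ L B)
    (k : ℕ) :
    Integrable (fun ω => (S k ω - U k ω) * γ (δ * waitingTime U S k ω)) P ∧
      ∫ ω, (S k ω - U k ω) * γ (δ * waitingTime U S k ω) ∂P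
        = (∫ ω, (S 0 ω - U 0 ω) ∂P) * ∫ ω, γ (δ * waitingTime U S k ω) ∂P := by
  have := hγ.continuous
  have hφ : Measurable fun x => γ (δ * x) := by fun_prop
  have hψ : Measurable fun p : ℝ × ℝ => p.2 - p.1 := by fun_prop
  simp only [mul_comm _ (γ _), mul_comm (∫ ω, (S 0 ω - U 0 ω) ∂P)]
  exact ⟨h.integrable_waitingTime_mul k hφ hψ (h.integrable_testFunction_waitingTime hγ k)
    h.integrable_sub, h.integral_waitingTime_mul k hφ hψ⟩

lemma integral_increment_sq_mul_testFunction_deriv (h : IsQueue P U S)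
    (hγ : IsTestFunction γ γ₁ L B) (k : ℕ) :
    Integrable (fun ω => (S k ω - U k ω) ^ 2 / 2 * (δ * γ₁ (δ * waitingTime U S k ω))) P ∧
      ∫ ω, (S k ω - U k ω) ^ 2 / 2 * (δ * γ₁ (δ * waitingTime U S k ω)) ∂P
        = (∫ ω, (S 0 ω - U 0 ω) ^ 2 ∂P) / 2 * (δ * ∫ ω, γ₁ (δ * waitingTime U S k ω) ∂P) := by
  have := hγ.continuous_deriv
  have hφ : Measurable fun x => δ * γ₁ (δ * x) := by fun_prop
  have hψ : Measurable fun p : ℝ × ℝ => (p.2 - p.1) ^ 2 / 2 := by fun_prop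
  rw [← integral_div, ← integral_const_mul]
  simp only [mul_comm _ (δ * _), mul_comm (∫ ω, (S 0 ω - U 0 ω) ^ 2 / 2 ∂P)]
  exact ⟨h.integrable_waitingTime_mul k hφ hψ
    ((h.integrable_testFunction_deriv_waitingTime hγ k).const_mul δ)
    (h.integrable_sub_sq.div_const 2), h.integral_waitingTime_mul k hφ hψ⟩

lemma abs_integral_scaledPrimitive_step_le (h : IsQueue P U S) (hγ : IsTestFunction γ γ₁ L B)
    (hδ : 0 ≤ δ) (hdrift : ∫ ω, (S 0 ω - U 0 ω) ∂P = -((∫ ω, U 0 ω ∂P) * δ))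
    (hc : ∫ ω, (S 0 ω - U 0 ω) ^ 2 ∂P = 2 * ((∫ ω, U 0 ω ∂P) * c)) (k : ℕ) :
    |∫ ω, scaledPrimitive γ δ (waitingTime U S (k + 1) ω) ∂P
        - ∫ ω, scaledPrimitive γ δ (waitingTime U S k ω) ∂P
        - (∫ ω, U 0 ω ∂P) * δ * ∫ ω, steinOperator c γ γ₁ (δ * waitingTime U S k ω) ∂P|
      ≤ δ * ∫ ω, idleTime U S k ω ^ 2 ∂P + L * δ ^ 2 * ∫ ω, |S 0 ω - U 0 ω| ^ 3 ∂P := by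
  have hψ : Measurable fun p : ℝ × ℝ => |p.2 - p.1| ^ 3 := by fun_prop
  have hΓ := h.integrable_scaledPrimitive_waitingTime (δ := δ) hγ
  obtain ⟨hi₁, he₁⟩ := h.integral_increment_mul_testFunction (δ := δ) hγ k
  obtain ⟨hi₂, he₂⟩ := h.integral_increment_sq_mul_testFunction_deriv (δ := δ) hγ k
  have hidle := (h.integrable_idleTime_sq k).const_mul δ
  have hcube := (h.integrable_pair k hψ h.integrable_abs_sub_pow_three).const_mul (L * δ ^ 2)
  have key := abs_integral_le_integral_of_abs_le
    (hγ.abs_scaledPrimitive_waitingTime_sub_le (U := U) (S := S) hδ k) (hidle.add hcube)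
  rw [integral_sub (((hΓ (k + 1)).sub' (hΓ k)).sub' hi₁) hi₂,
    integral_sub ((hΓ (k + 1)).sub' (hΓ k)) hi₁, integral_sub (hΓ (k + 1)) (hΓ k), he₁,
    he₂, hdrift, hc, integral_add hidle hcube, integral_const_mul, integral_const_mul,
    h.integral_pair k hψ] at key
  rw [h.integral_steinOperator_waitingTime hγ]
  convert key using 2
  ring

lemma abs_integral_scaledPrimitive_sub_le (h : IsQueue P U S) (hγ : IsTestFunction γ γ₁ L B)
    (hδ : 0 ≤ δ) (hdrift : ∫ ω, (S 0 ω - U 0 ω) ∂P = -((∫ ω, U 0 ω ∂P) * δ))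
    (hc : ∫ ω, (S 0 ω - U 0 ω) ^ 2 ∂P = 2 * ((∫ ω, U 0 ω ∂P) * c)) (n : ℕ) :
    |∫ ω, scaledPrimitive γ δ (waitingTime U S n ω) ∂P
        - (∫ ω, U 0 ω ∂P) * δ * ∑ k ∈ Finset.range n,
          ∫ ω, steinOperator c γ γ₁ (δ * waitingTime U S k ω) ∂P|
      ≤ δ * ∑ k ∈ Finset.range n, ∫ ω, idleTime U S k ω ^ 2 ∂P
        + n * (L * δ ^ 2 * ∫ ω, |S 0 ω - U 0 ω| ^ 3 ∂P) := by
  have hsum := abs_sub_sub_sum_le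
    (x := fun k => ∫ ω, scaledPrimitive γ δ (waitingTime U S k ω) ∂P)
    (y := fun k => (∫ ω, U 0 ω ∂P) * δ * ∫ ω, steinOperator c γ γ₁ (δ * waitingTime U S k ω) ∂P)
    (h.abs_integral_scaledPrimitive_step_le hγ hδ hdrift hc) n
  simpa [waitingTime_zero, scaledPrimitive, Finset.sum_add_distrib, ← Finset.mul_sum] using hsum

section Depletion

variable (h : IsQueue P U S) (hγ : IsTestFunction γ γ₁ L B)
include h hγ

lemma integrable_depletionPrimitive_waitingTime (hδ : 0 ≤ δ) (hc : 0 ≤ c) (k : ℕ) :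
    Integrable (fun ω => depletionPrimitive c γ δ (waitingTime U S k ω)) P :=
  h.integrable_comp_waitingTime hγ.continuous_depletionPrimitive.measurable
    (hγ.abs_depletionPrimitive_le hδ hc) k

lemma integrable_depletionPrimitive_waitingTime_add (hδ : 0 ≤ δ) (hc : 0 ≤ c) (k : ℕ) :
    Integrable (fun ω => depletionPrimitive c γ δ (waitingTime U S k ω + S k ω)) P := by
  have hS : Integrable (S k) P :=
    h.integrable_pair k measurable_snd (h.memLp_S.integrable (by norm_num))
  exact ((integrable_const (c / δ * B)).add
    (((h.integrable_waitingTime k).add hS).abs.const_mul B)).mono'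
    (hγ.continuous_depletionPrimitive.measurable.comp
      ((h.measurable_waitingTime k).add (h.measurable_S k))).aestronglyMeasurable
    (Eventually.of_forall fun ω => hγ.abs_depletionPrimitive_le hδ hc _)

lemma integral_steinOperator_interarrival (hδ : 0 < δ) (hc : 0 ≤ c) (k : ℕ) :
    ∫ ω, (∫ r in 0..U k ω, steinOperator c γ γ₁ (δ * max (workAfterArrival U S ω k - r) 0)) ∂P
      = ∫ ω, depletionPrimitive c γ δ (waitingTime U S k ω + S k ω) ∂P
        - ∫ ω, depletionPrimitive c γ δ (waitingTime U S (k + 1) ω) ∂P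
        + steinOperator c γ γ₁ 0 * ∫ ω, idleTime U S k ω ∂P := by
  have hΦ := h.integrable_depletionPrimitive_waitingTime hγ hδ.le hc (k + 1)
  have hΦ' := h.integrable_depletionPrimitive_waitingTime_add hγ hδ.le hc k
  rw [← integral_sub hΦ' hΦ, ← integral_const_mul,
    ← integral_add (hΦ'.sub' hΦ) ((h.integrable_idleTime k).const_mul _)]
  refine integral_congr_ae ?_
  filter_upwards [h.nonneg_S k] with ω hω
  have hq : 0 ≤ waitingTime U S k ω + S k ω := add_nonneg (waitingTime_nonneg k ω) hω
  rw [workAfterArrival_eq, hγ.integral_steinOperator_depletion hδ.ne' hq, waitingTime_succ,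
    idleTime, ← add_sub_assoc, mul_comm (steinOperator c γ γ₁ 0), sub_sub, add_comm (S k ω)]

lemma abs_integral_depletionPrimitive_service_le (hδ : 0 < δ) (hc : 0 ≤ c) (k : ℕ) :
    |∫ ω, depletionPrimitive c γ δ (waitingTime U S k ω + S k ω) ∂P
        - ∫ ω, depletionPrimitive c γ δ (waitingTime U S k ω) ∂P
        - (∫ ω, S 0 ω ∂P) * ∫ ω, steinOperator c γ γ₁ (δ * waitingTime U S k ω) ∂P|
      ≤ δ * (c * L + 1) * ∫ ω, S 0 ω ^ 2 ∂P := by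
  have hf : Continuous (steinOperator c γ γ₁) := hγ.continuous_steinOperator
  have hφ : Measurable fun x => steinOperator c γ γ₁ (δ * x) := by fun_prop
  have hψ : Measurable fun p : ℝ × ℝ => p.2 ^ 2 := by fun_prop
  have hΦ := h.integrable_depletionPrimitive_waitingTime hγ hδ.le hc k
  have hΦ' := h.integrable_depletionPrimitive_waitingTime_add hγ hδ.le hc k
  have hfW := h.integrable_comp_waitingTime hφ (D := c + B) (E := 0)
    (fun x => by simpa using hγ.abs_steinOperator_le hc _) k
  have hprod := h.integrable_waitingTime_mul k hφ measurable_snd hfW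
    (h.memLp_S.integrable (by norm_num))
  have hprod' := h.integral_waitingTime_mul k hφ measurable_snd
  have key := abs_integral_le_integral_of_abs_le
    (fun ω => hγ.abs_depletionPrimitive_sub_le hδ hc (waitingTime U S k ω) (S k ω))
    ((h.integrable_pair k hψ (h.integrable_S_pow (by norm_num : 2 ≤ 3))).const_mul
      (δ * (c * L + 1)))
  simp only [mul_comm (S k _)] at key
  rwa [integral_sub (hΦ'.sub' hΦ) hprod, integral_sub hΦ' hΦ, hprod', integral_const_mul,
    h.integral_pair k hψ, mul_comm _ (∫ ω, S 0 ω ∂P)] at key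

lemma abs_integral_depletionPrimitive_add_sub_le (hδ : 0 < δ) (hc : 0 ≤ c) (n : ℕ) :
    |∫ ω, depletionPrimitive c γ δ (waitingTime U S n ω) ∂P
        + ∑ k ∈ Finset.range n, ∫ ω, (∫ r in 0..U k ω,
            steinOperator c γ γ₁ (δ * max (workAfterArrival U S ω k - r) 0)) ∂P
        - steinOperator c γ γ₁ 0 * ∑ k ∈ Finset.range n, ∫ ω, idleTime U S k ω ∂P
        - (∫ ω, S 0 ω ∂P) * ∑ k ∈ Finset.range n,
            ∫ ω, steinOperator c γ γ₁ (δ * waitingTime U S k ω) ∂P|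
      ≤ n * (δ * (c * L + 1) * ∫ ω, S 0 ω ^ 2 ∂P) := by
  have hsum := abs_sub_sub_sum_le (x := fun k =>
      ∫ ω, depletionPrimitive c γ δ (waitingTime U S k ω) ∂P) (y := fun k =>
      steinOperator c γ γ₁ 0 * (∫ ω, idleTime U S k ω ∂P)
        + (∫ ω, S 0 ω ∂P) * (∫ ω, steinOperator c γ γ₁ (δ * waitingTime U S k ω) ∂P)
        - ∫ ω, (∫ r in 0..U k ω,
            steinOperator c γ γ₁ (δ * max (workAfterArrival U S ω k - r) 0)) ∂P)
    (e := fun _ => δ * (c * L + 1) * ∫ ω, S 0 ω ^ 2 ∂P) (fun k => ?_) n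
  · simp only [waitingTime_zero, hγ.depletionPrimitive_zero, integral_zero, sub_zero,
      Finset.sum_sub_distrib, Finset.sum_add_distrib, ← Finset.mul_sum, Finset.sum_const,
      Finset.card_range, nsmul_eq_mul] at hsum
    refine (le_of_eq ?_).trans (hsum.trans_eq (by ring))
    congr 1
    ring
  · convert h.abs_integral_depletionPrimitive_service_le hγ hδ hc k using 2
    rw [h.integral_steinOperator_interarrival hγ hδ hc]
    ring

end Depletion

end IsQueue

/-! ### The Stein operator at the limiting workload -/

namespace IsQueue

variable {Ω Ω' : Type*} [MeasurableSpace Ω] [MeasurableSpace Ω'] {P : Measure Ω}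
  [IsProbabilityMeasure P] {P' : Measure Ω'} [IsProbabilityMeasure P']
  {U S : ℕ → Ω → ℝ} {X : Ω' → ℝ} {γ γ₁ : ℝ → ℝ} {L B c δ K : ℝ}

lemma integral_sub_eq_neg_mul_one_sub_utilization (h : IsQueue P U S)
    (ha : 0 < ∫ ω, U 0 ω ∂P) :
    ∫ ω, (S 0 ω - U 0 ω) ∂P = -((∫ ω, U 0 ω ∂P) * (1 - utilization U S P)) := by
  rw [integral_sub (h.memLp_S.integrable (by norm_num)) (h.memLp_U.integrable (by norm_num)),
    utilization, arrivalRate]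
  field_simp
  ring

lemma mul_abs_sum_integral_steinOperator_le (h : IsQueue P U S) (hγ : IsTestFunction γ γ₁ L B)
    (ha : 0 ≤ ∫ ω, U 0 ω ∂P) (hδ : 0 ≤ δ)
    (hdrift : ∫ ω, (S 0 ω - U 0 ω) ∂P = -((∫ ω, U 0 ω ∂P) * δ))
    (hc : ∫ ω, (S 0 ω - U 0 ω) ^ 2 ∂P = 2 * ((∫ ω, U 0 ω ∂P) * c)) {n : ℕ}
    (hK : ∑ k ∈ Finset.range n, ∫ ω, idleTime U S k ω ^ 2 ∂P
      ≤ K * ∑ k ∈ Finset.range n, ∫ ω, idleTime U S k ω ∂P) :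
    (∫ ω, U 0 ω ∂P) * δ * |∑ k ∈ Finset.range n,
        ∫ ω, steinOperator c γ γ₁ (δ * waitingTime U S k ω) ∂P|
      ≤ B * (∫ ω, waitingTime U S n ω ∂P) + n * (L * δ ^ 2 * ∫ ω, |S 0 ω - U 0 ω| ^ 3 ∂P)
        + δ * (K * ∑ k ∈ Finset.range n, ∫ ω, idleTime U S k ω ∂P) := by
  have hΓ := h.abs_integral_comp_waitingTime_le (D := 0)
    (fun x => by simpa using hγ.abs_scaledPrimitive_le δ x) n
  have hsum := h.abs_integral_scaledPrimitive_sub_le hγ hδ hdrift hc n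
  have hidle := mul_le_mul_of_nonneg_left hK hδ
  rw [abs_sub_comm] at hsum
  have hE := (abs_sub_abs_le_abs_sub _ _).trans hsum
  rw [abs_mul, abs_of_nonneg (mul_nonneg ha hδ)] at hE
  linarith

lemma abs_sum_integral_interarrival_le (h : IsQueue P U S) (hγ : IsTestFunction γ γ₁ L B)
    (hδ : 0 < δ) (hc : 0 ≤ c) (n : ℕ) :
    |∑ k ∈ Finset.range n, ∫ ω, (∫ r in 0..U k ω,
        steinOperator c γ γ₁ (δ * max (workAfterArrival U S ω k - r) 0)) ∂P|
      ≤ c / δ * B + B * (∫ ω, waitingTime U S n ω ∂P)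
        + c * ∑ k ∈ Finset.range n, ∫ ω, idleTime U S k ω ∂P
        + (∫ ω, S 0 ω ∂P) * |∑ k ∈ Finset.range n,
          ∫ ω, steinOperator c γ γ₁ (δ * waitingTime U S k ω) ∂P|
        + n * (δ * (c * L + 1) * ∫ ω, S 0 ω ^ 2 ∂P) := by
  have hsum := h.abs_integral_depletionPrimitive_add_sub_le hγ hδ hc n
  have hΦ := h.abs_integral_comp_waitingTime_le (hγ.abs_depletionPrimitive_le hδ.le hc) n
  set A := ∑ k ∈ Finset.range n, ∫ ω, (∫ r in 0..U k ω,
    steinOperator c γ γ₁ (δ * max (workAfterArrival U S ω k - r) 0)) ∂P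
  set Φ := ∫ ω, depletionPrimitive c γ δ (waitingTime U S n ω) ∂P
  set I := ∑ k ∈ Finset.range n, ∫ ω, idleTime U S k ω ∂P
  set E := ∑ k ∈ Finset.range n, ∫ ω, steinOperator c γ γ₁ (δ * waitingTime U S k ω) ∂P
  have hI : 0 ≤ I := Finset.sum_nonneg fun k _ => integral_nonneg fun ω => idleTime_nonneg k ω
  have hempty : |steinOperator c γ γ₁ 0 * I| ≤ c * I := by
    rw [abs_mul, abs_of_nonneg hI]
    exact mul_le_mul_of_nonneg_right (hγ.abs_steinOperator_zero_le hc) hI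
  have hE : |(∫ ω, S 0 ω ∂P) * E| = (∫ ω, S 0 ω ∂P) * |E| := by
    rw [abs_mul, abs_of_nonneg (integral_nonneg_of_ae (h.nonneg_S 0))]
  rw [← hE]
  rw [abs_le] at hsum hΦ hempty ⊢
  constructor <;> linarith [le_abs_self ((∫ ω, S 0 ω ∂P) * E),
    neg_abs_le ((∫ ω, S 0 ω ∂P) * E)]

lemma abs_sum_integral_interarrival_div_le (h : IsQueue P U S) (hγ : IsTestFunction γ γ₁ L B)
    (ha : 0 < ∫ ω, U 0 ω ∂P) (hδ : 0 < δ)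
    (hdrift : ∫ ω, (S 0 ω - U 0 ω) ∂P = -((∫ ω, U 0 ω ∂P) * δ)) (hc₀ : 0 ≤ c)
    (hc : ∫ ω, (S 0 ω - U 0 ω) ^ 2 ∂P = 2 * ((∫ ω, U 0 ω ∂P) * c)) {n : ℕ} (hn : 0 < n)
    (hK : ∑ k ∈ Finset.range n, ∫ ω, idleTime U S k ω ^ 2 ∂P
      ≤ K * ∑ k ∈ Finset.range n, ∫ ω, idleTime U S k ω ∂P) :
    |(∑ k ∈ Finset.range n, ∫ ω, (∫ r in 0..U k ω,
        steinOperator c γ γ₁ (δ * max (workAfterArrival U S ω k - r) 0)) ∂P) / n|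
      ≤ c / δ * B / n + B * ((∫ ω, waitingTime U S n ω ∂P) / n)
        + c * ((∫ ω, waitingTime U S n ω ∂P) / n + (∫ ω, U 0 ω ∂P) * δ)
        + (∫ ω, S 0 ω ∂P) / ((∫ ω, U 0 ω ∂P) * δ)
          * (B * ((∫ ω, waitingTime U S n ω ∂P) / n)
            + L * δ ^ 2 * (∫ ω, |S 0 ω - U 0 ω| ^ 3 ∂P)
            + δ * (K * ((∫ ω, waitingTime U S n ω ∂P) / n + (∫ ω, U 0 ω ∂P) * δ)))
        + δ * (c * L + 1) * ∫ ω, S 0 ω ^ 2 ∂P := by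
  have hn' : (0 : ℝ) < n := by exact_mod_cast hn
  have hA := h.abs_sum_integral_interarrival_le hγ hδ hc₀ n
  have hE := h.mul_abs_sum_integral_steinOperator_le hγ ha.le hδ.le hdrift hc hK
  have hI := h.sum_integral_idleTime n
  rw [hdrift] at hI
  have hb : 0 ≤ ∫ ω, S 0 ω ∂P := integral_nonneg_of_ae (h.nonneg_S 0)
  rw [← le_div_iff₀' (mul_pos ha hδ)] at hE
  have hbE := mul_le_mul_of_nonneg_left hE hb
  rw [abs_div, abs_of_pos hn', div_le_iff₀ hn']
  refine hA.trans ((add_le_add_left (add_le_add_right hbE _) _).trans_eq ?_)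
  rw [hI]
  field_simp
  ring

lemma abs_integral_steinOperator_limit_le (h : IsQueue P U S)
    (hX : TendstoInDistribution (scaledWorkload U S P) atTop X (fun _ : ℝ => P) P')
    (hγ : IsTestFunction γ γ₁ L B) (ha : 0 < ∫ ω, U 0 ω ∂P) (hρ : utilization U S P < 1)
    (hc₀ : 0 ≤ c) (hc : ∫ ω, (S 0 ω - U 0 ω) ^ 2 ∂P = 2 * ((∫ ω, U 0 ω ∂P) * c))
    (hK : ∀ n : ℕ, ∑ k ∈ Finset.range n, ∫ ω, idleTime U S k ω ^ 2 ∂P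
      ≤ K * ∑ k ∈ Finset.range n, ∫ ω, idleTime U S k ω ∂P) :
    (∫ ω, U 0 ω ∂P) * |∫ ω, steinOperator c γ γ₁ (X ω) ∂P'|
      ≤ (1 - utilization U S P) * (c * (∫ ω, U 0 ω ∂P)
        + (∫ ω, S 0 ω ∂P) / (∫ ω, U 0 ω ∂P)
          * (L * (∫ ω, |S 0 ω - U 0 ω| ^ 3 ∂P) + K * ∫ ω, U 0 ω ∂P)
        + (c * L + 1) * ∫ ω, S 0 ω ^ 2 ∂P) := by
  have hδ : 0 < 1 - utilization U S P := sub_pos.2 hρ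
  have hdrift := h.integral_sub_eq_neg_mul_one_sub_utilization ha
  have hlim := (h.tendsto_average_workload hX hγ.continuous_steinOperator
    (hγ.abs_steinOperator_le hc₀)).abs
  have hw := h.tendsto_integral_waitingTime_div
    (hdrift.trans_le (neg_nonpos.2 (mul_pos ha hδ).le))
  rw [abs_mul, abs_of_pos ha] at hlim
  refine (le_of_tendsto_of_tendsto hlim
    (((((tendsto_const_div_atTop_nhds_zero_nat _).add (hw.const_mul B)).add
      ((hw.add_const _).const_mul c)).add
      ((((hw.const_mul B).add_const _).add
        (((hw.add_const _).const_mul K).const_mul _)).const_mul _)).add_const _)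
    ((eventually_gt_atTop 0).mono fun n hn =>
      h.abs_sum_integral_interarrival_div_le hγ ha hδ hdrift hc₀ hc hn (hK n))).trans_eq ?_
  field_simp
  ring

end IsQueue

lemma isTestFunction_steinSol {r B L : ℝ} {φ φ' : ℝ → ℝ} (hr : 0 < r)
    (hd : ∀ x, HasDerivAt φ (φ' x) x) (hB : ∀ x, |φ x| ≤ B) (h₁ : ∀ x, |φ' x| ≤ 1)
    (hL : ∀ x y, |φ' x - φ' y| ≤ L * |x - y|) (hm : Measurable φ') :
    IsTestFunction (steinSol r φ) (steinSolDeriv r φ') L (2 * B) where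
  hasDerivAt := hasDerivAt_steinSol hr hd hB h₁ hm
  abs_deriv_le := abs_steinSolDeriv_le hr h₁
  abs_deriv_sub_le := abs_steinSolDeriv_sub_le hr h₁ hm hL
  abs_le := abs_steinSol_le hr hB
  zero := steinSol_zero

lemma one_div_expRate {Ω : Type*} [MeasurableSpace Ω] {P : Measure Ω} {U S : ℕ → Ω → ℝ} :
    1 / expRate U S P = (∫ ω, (U 0 ω - S 0 ω) ^ 2 ∂P) / (2 * ∫ ω, U 0 ω ∂P) := by
  rw [expRate, arrivalRate, one_div_div, one_div_mul_eq_div, div_div, mul_comm 2]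

namespace IsQueue

variable {Ω Ω' : Type*} [MeasurableSpace Ω] [MeasurableSpace Ω'] {P : Measure Ω}
  [IsProbabilityMeasure P] {P' : Measure Ω'} [IsProbabilityMeasure P']
  {U S : ℕ → Ω → ℝ} {X : Ω' → ℝ} {φ φ' : ℝ → ℝ} {L B K : ℝ}

lemma abs_integral_sub_integral_exp_le_of_abs_le (h : IsQueue P U S)
    (hX : TendstoInDistribution (scaledWorkload U S P) atTop X (fun _ : ℝ => P) P')
    (ha : 0 < ∫ ω, U 0 ω ∂P) (hρ : utilization U S P < 1)
    (hv : 0 < ∫ ω, (U 0 ω - S 0 ω) ^ 2 ∂P)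
    (hK : ∀ n : ℕ, ∑ k ∈ Finset.range n, ∫ ω, idleTime U S k ω ^ 2 ∂P
      ≤ K * ∑ k ∈ Finset.range n, ∫ ω, idleTime U S k ω ∂P)
    (hd : ∀ x, HasDerivAt φ (φ' x) x) (hB : ∀ x, |φ x| ≤ B) (h₁ : ∀ x, |φ' x| ≤ 1)
    (hL : ∀ x y, |φ' x - φ' y| ≤ L * |x - y|) (hm : Measurable φ') :
    (∫ ω, U 0 ω ∂P) * |∫ ω, φ (X ω) ∂P' - ∫ y, φ y ∂(expMeasure (expRate U S P))|
      ≤ (1 - utilization U S P) * ((∫ ω, (U 0 ω - S 0 ω) ^ 2 ∂P) / 2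
        + (∫ ω, S 0 ω ∂P) / (∫ ω, U 0 ω ∂P)
          * (L * (∫ ω, |S 0 ω - U 0 ω| ^ 3 ∂P) + K * ∫ ω, U 0 ω ∂P)
        + ((∫ ω, (U 0 ω - S 0 ω) ^ 2 ∂P) / (2 * ∫ ω, U 0 ω ∂P) * L + 1)
          * ∫ ω, S 0 ω ^ 2 ∂P) := by
  have hr : 0 < expRate U S P := by
    rw [expRate, arrivalRate]
    positivity
  have hstein := h.abs_integral_steinOperator_limit_le hX
    (isTestFunction_steinSol hr hd hB h₁ hL hm) ha hρ (c := 1 / expRate U S P) (by positivity)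
    (by simp only [one_div_expRate, sub_sq_comm (S 0 _)]; field_simp) hK
  have hφ : Continuous φ := continuous_iff_continuousAt.2 fun x => (hd x).continuousAt
  have hφX : Integrable (fun ω => φ (X ω)) P' :=
    .of_bound (hφ.measurable.comp_aemeasurable hX.aemeasurable_limit).aestronglyMeasurable B
      (Eventually.of_forall fun ω => hB _)
  simp_rw [steinOperator, stein_equation hr hd hB h₁ hm] at hstein
  rw [integral_sub hφX (integrable_const _), integral_const, probReal_univ, one_smul,
    one_div_expRate] at hstein
  refine hstein.trans_eq ?_
  field_simp

end IsQueue

/-! ### Truncation of test functions -/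

section Truncation

lemma abs_arctan_le_abs (x : ℝ) : |Real.arctan x| ≤ |x| := by
  have h := abs_sub_le_of_abs_deriv_le (a := x) (K := 1) Real.hasDerivAt_arctan fun s _ => by
    rw [abs_of_nonneg (by positivity), div_le_one (by positivity)]
    exact le_add_of_nonneg_right (sq_nonneg s)
  simpa using h

/-- A smooth truncation of the function `h` at height of order `n + 1`, by which the bounds for
bounded test functions extend to Lipschitz ones. -/
noncomputable def truncate (h : ℝ → ℝ) (n : ℕ) (x : ℝ) : ℝ :=
  ((n : ℝ) + 1) * Real.arctan (h x / ((n : ℝ) + 1))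

/-- The derivative of `truncate h n` if `h'` is the derivative of `h`. -/
noncomputable def truncateDeriv (h h' : ℝ → ℝ) (n : ℕ) (x : ℝ) : ℝ :=
  h' x / (1 + (h x / ((n : ℝ) + 1)) ^ 2)

variable {h h' h'' : ℝ → ℝ}

lemma continuous_truncate (hh : Continuous h) (n : ℕ) : Continuous (truncate h n) := by
  unfold truncate
  fun_prop

lemma abs_truncate_le (h : ℝ → ℝ) (n : ℕ) (x : ℝ) : |truncate h n x| ≤ |h x| := by
  have hn : (0 : ℝ) < (n : ℝ) + 1 := by positivity
  rw [truncate, abs_mul, abs_of_pos hn, ← le_div_iff₀' hn]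
  refine (abs_arctan_le_abs _).trans_eq ?_
  rw [abs_div, abs_of_pos hn]

lemma abs_truncate_le_const (h : ℝ → ℝ) (n : ℕ) (x : ℝ) :
    |truncate h n x| ≤ ((n : ℝ) + 1) * (Real.pi / 2) := by
  have hn : (0 : ℝ) < (n : ℝ) + 1 := by positivity
  rw [truncate, abs_mul, abs_of_pos hn]
  exact mul_le_mul_of_nonneg_left
    (abs_le.2 ⟨(Real.neg_pi_div_two_lt_arctan _).le, (Real.arctan_lt_pi_div_two _).le⟩) hn.le

lemma truncate_nonneg {n : ℕ} {x : ℝ} (hx : 0 ≤ h x) : 0 ≤ truncate h n x :=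
  mul_nonneg (by positivity) (Real.arctan_nonneg.2 (by positivity))

lemma tendsto_truncate (h : ℝ → ℝ) (x : ℝ) :
    Tendsto (fun n => truncate h n x) atTop (𝓝 (h x)) := by
  have hd : HasDerivAt (fun t => Real.arctan (h x * t)) (h x) 0 :=
    ((hasDerivAt_id (0 : ℝ)).const_mul (h x)).arctan.congr_deriv (by simp)
  have hlim : Tendsto (fun n : ℕ => 1 / ((n : ℝ) + 1)) atTop (𝓝[≠] 0) :=
    tendsto_nhdsWithin_iff.2 ⟨tendsto_one_div_add_atTop_nhds_zero_nat,
      Eventually.of_forall fun n => (by positivity : (1 : ℝ) / ((n : ℝ) + 1) ≠ 0)⟩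
  refine (hd.tendsto_slope_zero.comp hlim).congr fun n => ?_
  simp [truncate, div_eq_mul_inv]

lemma hasDerivAt_truncate (h₁ : ∀ x, HasDerivAt h (h' x) x) (n : ℕ) (x : ℝ) :
    HasDerivAt (truncate h n) (truncateDeriv h h' n x) x := by
  refine (((h₁ x).div_const ((n : ℝ) + 1)).arctan.const_mul ((n : ℝ) + 1)).congr_deriv ?_
  rw [truncateDeriv]
  field_simp

lemma abs_truncateDeriv_le (hb : ∀ x, |h' x| ≤ 1) (n : ℕ) (x : ℝ) :
    |truncateDeriv h h' n x| ≤ 1 := by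
  rw [truncateDeriv, abs_div, abs_of_pos (by positivity : 0 < 1 + (h x / ((n : ℝ) + 1)) ^ 2),
    div_le_one (by positivity)]
  linarith [hb x, sq_nonneg (h x / ((n : ℝ) + 1))]

lemma hasDerivAt_truncateDeriv (h₁ : ∀ x, HasDerivAt h (h' x) x)
    (h₂ : ∀ x, HasDerivAt h' (h'' x) x) (n : ℕ) (x : ℝ) :
    HasDerivAt (truncateDeriv h h' n)
      ((h'' x * (1 + (h x / (n + 1)) ^ 2) - h' x * (2 * (h x / (n + 1)) * (h' x / (n + 1))))
        / (1 + (h x / (n + 1)) ^ 2) ^ 2) x := by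
  refine ((h₂ x).div ((((h₁ x).div_const ((n : ℝ) + 1)).pow 2).const_add 1)
    (show 1 + (h x / ((n : ℝ) + 1)) ^ 2 ≠ 0 by positivity)).congr_deriv ?_
  simp

lemma abs_truncate_second_deriv_le {y a b N : ℝ} (ha : |a| ≤ 1) (hb : |b| ≤ 1) (hN : 1 ≤ N) :
    |(b * (1 + y ^ 2) - a * (2 * y * (a / N))) / (1 + y ^ 2) ^ 2| ≤ 2 := by
  have hy : 0 < 1 + y ^ 2 := by positivity
  have hfirst : |b * (1 + y ^ 2)| ≤ 1 + y ^ 2 := by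
    rw [abs_mul, abs_of_pos hy]
    exact mul_le_of_le_one_left hy.le hb
  have hsecond : |a * (2 * y * (a / N))| ≤ 1 + y ^ 2 := by
    have haN : |a / N| ≤ 1 := by
      rw [abs_div, abs_of_pos (zero_lt_one.trans_le hN), div_le_one (zero_lt_one.trans_le hN)]
      exact ha.trans hN
    have hy₂ : |2 * y| ≤ 1 + y ^ 2 := by
      rw [abs_mul, abs_two, ← sq_abs y]
      linarith [two_mul_le_add_sq 1 |y|]
    calc |a * (2 * y * (a / N))| = |a| * (|2 * y| * |a / N|) := by rw [abs_mul, abs_mul]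
      _ ≤ 1 * ((1 + y ^ 2) * 1) := by gcongr
      _ = 1 + y ^ 2 := by ring
  rw [abs_div, abs_of_pos (by positivity : 0 < (1 + y ^ 2) ^ 2), div_le_iff₀ (by positivity)]
  calc |b * (1 + y ^ 2) - a * (2 * y * (a / N))| ≤ (1 + y ^ 2) + (1 + y ^ 2) :=
        (abs_sub _ _).trans (add_le_add hfirst hsecond)
    _ ≤ 2 * (1 + y ^ 2) ^ 2 := by nlinarith [sq_nonneg y]

lemma abs_truncateDeriv_sub_le (h₁ : ∀ x, HasDerivAt h (h' x) x)
    (h₂ : ∀ x, HasDerivAt h' (h'' x) x) (hb₁ : ∀ x, |h' x| ≤ 1) (hb₂ : ∀ x, |h'' x| ≤ 1)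
    (n : ℕ) (x y : ℝ) :
    |truncateDeriv h h' n x - truncateDeriv h h' n y| ≤ 2 * |x - y| :=
  convex_univ.norm_image_sub_le_of_norm_hasDerivWithin_le
    (fun z _ => (hasDerivAt_truncateDeriv h₁ h₂ n z).hasDerivWithinAt)
    (fun z _ => abs_truncate_second_deriv_le (hb₁ z) (hb₂ z) (by simp)) trivial trivial

lemma tendsto_integral_truncate {α : Type*} [MeasurableSpace α] {μ : Measure α} {Z : α → ℝ}
    (hc : Continuous h) (hZ : AEMeasurable Z μ) (hi : Integrable (fun ω => h (Z ω)) μ) :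
    Tendsto (fun n => ∫ ω, truncate h n (Z ω) ∂μ) atTop (𝓝 (∫ ω, h (Z ω) ∂μ)) :=
  tendsto_integral_of_dominated_convergence (fun ω => |h (Z ω)|)
    (fun n =>
      ((continuous_truncate hc n).measurable.comp_aemeasurable hZ).aestronglyMeasurable) hi.abs
    (fun n => Eventually.of_forall fun ω => abs_truncate_le h n (Z ω))
    (Eventually.of_forall fun ω => tendsto_truncate h (Z ω))

end Truncation

lemma integrable_comp_of_abs_deriv_le {α : Type*} [MeasurableSpace α] {μ : Measure α}
    [IsFiniteMeasure μ] {Z : α → ℝ} {h h' : ℝ → ℝ} (hZ : Integrable Z μ)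
    (h₁ : ∀ x, HasDerivAt h (h' x) x) (hb : ∀ x, |h' x| ≤ 1) :
    Integrable (fun ω => h (Z ω)) μ := by
  have hc : Continuous h := continuous_iff_continuousAt.2 fun x => (h₁ x).continuousAt
  refine ((integrable_const |h 0|).add hZ.abs).mono'
    (hc.comp_aestronglyMeasurable hZ.aestronglyMeasurable) (Eventually.of_forall fun ω => ?_)
  have hlip := abs_sub_le_of_abs_deriv_le h₁ (a := Z ω) (K := 1) fun s _ => hb s
  rw [one_mul] at hlip
  exact (abs_sub_abs_le_abs_sub _ _).trans hlip |> sub_le_iff_le_add'.1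

lemma integrable_of_tendsto_of_integral_abs_le {α : Type*} [MeasurableSpace α] {μ : Measure α}
    {f : ℕ → α → ℝ} {F : α → ℝ} {D : ℝ} (hf : ∀ n, Integrable (f n) μ)
    (hlim : ∀ ω, Tendsto (fun n => f n ω) atTop (𝓝 (F ω))) (hD : ∀ n, ∫ ω, |f n ω| ∂μ ≤ D) :
    Integrable F μ := by
  have hF := aestronglyMeasurable_of_tendsto_ae atTop (fun n => (hf n).aestronglyMeasurable)
    (Eventually.of_forall hlim)
  refine memLp_one_iff_integrable.1 ⟨hF, (Lp.eLpNorm_le_of_ae_tendsto (u := atTop)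
    (C := ENNReal.ofReal D) (Eventually.of_forall fun n => ?_)
    (fun n => (hf n).aestronglyMeasurable) (Eventually.of_forall hlim)).trans_lt
      ENNReal.ofReal_lt_top⟩
  rw [eLpNorm_one_eq_lintegral_enorm, ← ofReal_integral_norm_eq_lintegral_enorm (hf n)]
  exact ENNReal.ofReal_le_ofReal (hD n)

lemma ae_nonneg_of_tendstoInDistribution {Ω' ι : Type*} {Ωs : ι → Type*}
    [∀ i, MeasurableSpace (Ωs i)] [MeasurableSpace Ω'] {μ : ∀ i, Measure (Ωs i)}
    [∀ i, IsProbabilityMeasure (μ i)] {P' : Measure Ω'} [IsProbabilityMeasure P']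
    {l : Filter ι} [l.NeBot] {Z : ∀ i, Ωs i → ℝ} {X : Ω' → ℝ}
    (hX : TendstoInDistribution Z l X μ P') (hZ : ∀ i ω, 0 ≤ Z i ω) :
    ∀ᵐ ω ∂P', 0 ≤ X ω := by
  have hopen := ProbabilityMeasure.le_liminf_measure_open_of_tendsto hX.tendsto
    (isOpen_Iio (a := (0 : ℝ)))
  have hempty (i : ι) : Z i ⁻¹' Set.Iio 0 = ∅ :=
    Set.eq_empty_of_forall_notMem fun ω hω => (hZ i ω).not_gt hω
  simp only [ProbabilityMeasure.coe_mk, Measure.map_apply_of_aemeasurable hX.aemeasurable_limit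
    measurableSet_Iio, Measure.map_apply_of_aemeasurable (hX.forall_aemeasurable _)
    measurableSet_Iio, hempty, measure_empty, liminf_const, nonpos_iff_eq_zero] at hopen
  simp only [ae_iff, not_le]
  exact hopen

/-! ### Error bounds -/

lemma abs_sub_pow_le_add_pow {x y : ℝ} (hx : 0 ≤ x) (hy : 0 ≤ y) (k : ℕ) :
    |x - y| ^ k ≤ x ^ k + y ^ k := by
  rcases le_total x y with hxy | hxy
  · rw [abs_of_nonpos (sub_nonpos.2 hxy), neg_sub]
    exact (pow_le_pow_left₀ (sub_nonneg.2 hxy) (sub_le_self y hx) k).trans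
      (le_add_of_nonneg_left (pow_nonneg hx k))
  · rw [abs_of_nonneg (sub_nonneg.2 hxy)]
    exact (pow_le_pow_left₀ (sub_nonneg.2 hxy) (sub_le_self x hy) k).trans
      (le_add_of_nonneg_right (pow_nonneg hy k))

/-- The constant of the error bounds, where `p` is a lower bound of `P(U > 2 E S + 3)` and `u`, `s`
are the moments of `U` and `S`, numbered from `0`. The three summands of the numerator come from
the idle time, from the Taylor remainder together with the squared idle times, and from the work
that one customer brings, for a test function with a `2`-Lipschitz derivative. -/
noncomputable def errorConst (p : ℝ) (u s : Fin 3 → ℝ) : ℝ :=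
  ((u 1 + s 1) / 2 + (2 * (u 2 + s 2) + 2 * (u 1 + u 2) / p * u 0)
    + ((u 1 + s 1) / (2 * u 0) * 2 + 1) * s 1) / u 0

lemma continuousOn_errorConst {α : Type*} [TopologicalSpace α] {t : Set α} {p : α → ℝ}
    {u s : α → Fin 3 → ℝ} (hp : ContinuousOn p t) (hu : ContinuousOn u t) (hs : ContinuousOn s t)
    (hp₀ : ∀ x ∈ t, 0 < p x) (hu₀ : ∀ x ∈ t, 0 < u x 0) :
    ContinuousOn (fun x => errorConst (p x) (u x) (s x)) t := by
  unfold errorConst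
  have hp₁ : ∀ x ∈ t, p x ≠ 0 := fun x hx => (hp₀ x hx).ne'
  have hu₁ : ∀ x ∈ t, u x 0 ≠ 0 := fun x hx => (hu₀ x hx).ne'
  have hu₂ : ∀ x ∈ t, 2 * u x 0 ≠ 0 := fun x hx => mul_ne_zero two_ne_zero (hu₁ x hx)
  fun_prop (disch := assumption)

lemma integral_S_lt_integral_U {Ω : Type*} [MeasurableSpace Ω] {P : Measure Ω} {U S : ℕ → Ω → ℝ}
    (ha : 0 < ∫ ω, U 0 ω ∂P) (hρ : utilization U S P < 1) :
    ∫ ω, S 0 ω ∂P < ∫ ω, U 0 ω ∂P := by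
  rwa [utilization, arrivalRate, one_div_mul_eq_div, div_lt_one ha] at hρ

namespace IsQueue

variable {Ω Ω' : Type*} [MeasurableSpace Ω] [MeasurableSpace Ω'] {P : Measure Ω}
  [IsProbabilityMeasure P] {P' : Measure Ω'} [IsProbabilityMeasure P'] {U S : ℕ → Ω → ℝ}
  {X : Ω' → ℝ} {p : ℝ}

lemma integral_abs_sub_pow_le (h : IsQueue P U S) {k : ℕ} (hk : k ≤ 3) :
    ∫ ω, |S 0 ω - U 0 ω| ^ k ∂P ≤ ∫ ω, U 0 ω ^ k ∂P + ∫ ω, S 0 ω ^ k ∂P := by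
  have hU := h.integrable_U_pow hk
  have hS := h.integrable_S_pow hk
  rw [add_comm, ← integral_add hS hU]
  refine integral_mono_of_nonneg (Eventually.of_forall fun ω => by positivity) (hS.add hU) ?_
  filter_upwards [h.nonneg_pair 0] with ω hω
  exact abs_sub_pow_le_add_pow hω.2 hω.1 k

lemma integral_sub_sq_le (h : IsQueue P U S) :
    ∫ ω, (U 0 ω - S 0 ω) ^ 2 ∂P ≤ ∫ ω, U 0 ω ^ 2 ∂P + ∫ ω, S 0 ω ^ 2 ∂P := by
  simpa only [sq_abs, sub_sq_comm] using h.integral_abs_sub_pow_le (k := 2) (by norm_num)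

lemma integral_U_pos (h : IsQueue P U S) {y : ℝ} (hy : 0 < y) (hp : 0 < p)
    (hpU : p ≤ P.real {ω | y < U 0 ω}) : 0 < ∫ ω, U 0 ω ∂P :=
  calc 0 < y * p := mul_pos hy hp
    _ ≤ y * P.real {ω | y ≤ U 0 ω} := by
        gcongr
        exact hpU.trans (measureReal_mono fun ω (hω : y < U 0 ω) => hω.le)
    _ ≤ ∫ ω, U 0 ω ∂P :=
        mul_meas_ge_le_integral_of_nonneg (h.nonneg_U 0)
          (by simpa using h.integrable_U_pow (k := 1) (by norm_num)) y

lemma integral_sub_sq_pos (h : IsQueue P U S) (ha : 0 < ∫ ω, U 0 ω ∂P)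
    (hρ : utilization U S P < 1) : 0 < ∫ ω, (U 0 ω - S 0 ω) ^ 2 ∂P := by
  have hU : Integrable (U 0) P := by simpa using h.integrable_U_pow (k := 1) (by norm_num)
  have hS : Integrable (S 0) P := by simpa using h.integrable_S_pow (k := 1) (by norm_num)
  have hmean : ∫ ω, (S 0 ω - U 0 ω) ∂P ≠ 0 := by
    rw [integral_sub hS hU]
    exact (sub_neg.2 (integral_S_lt_integral_U ha hρ)).ne
  have hsq := sq_integral_le_integral_sq (h.memLp_sub.mono_exponent (p := 2) (by norm_num))
  simp only [sub_sq_comm (S 0 _)] at hsq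
  exact (sq_pos_of_ne_zero hmean).trans_le hsq

lemma expRate_pos (h : IsQueue P U S) (ha : 0 < ∫ ω, U 0 ω ∂P) (hρ : utilization U S P < 1) :
    0 < expRate U S P := by
  have hv := h.integral_sub_sq_pos ha hρ
  rw [expRate, arrivalRate]
  positivity

lemma abs_integral_sub_le_errorConst_of_abs_le (h : IsQueue P U S)
    (hX : TendstoInDistribution (scaledWorkload U S P) atTop X (fun _ : ℝ => P) P')
    (hρ : utilization U S P < 1) (hp : 0 < p)
    (hpU : p ≤ P.real {ω | 2 * ∫ ω, S 0 ω ∂P + 3 < U 0 ω}) {B : ℝ} {φ φ' : ℝ → ℝ}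
    (hd : ∀ x, HasDerivAt φ (φ' x) x) (hB : ∀ x, |φ x| ≤ B) (h₁ : ∀ x, |φ' x| ≤ 1)
    (hL : ∀ x y, |φ' x - φ' y| ≤ 2 * |x - y|) (hm : Measurable φ') :
    |∫ ω, φ (X ω) ∂P' - ∫ y, φ y ∂(expMeasure (expRate U S P))|
      ≤ (1 - utilization U S P) * errorConst p (moments P (U 0) 3) (moments P (S 0) 3) := by
  have hS : 0 ≤ ∫ ω, S 0 ω ∂P := integral_nonneg_of_ae (h.nonneg_S 0)
  have ha : 0 < ∫ ω, U 0 ω ∂P := h.integral_U_pos (by positivity) hp hpU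
  have hload : (∫ ω, S 0 ω ∂P) / ∫ ω, U 0 ω ∂P ≤ 1 :=
    (div_le_one ha).2 (integral_S_lt_integral_U ha hρ).le
  have hv := h.integral_sub_sq_le
  have hξ := h.integral_abs_sub_pow_le (k := 3) le_rfl
  have hu₃ : 0 ≤ ∫ ω, U 0 ω ^ 3 ∂P :=
    integral_nonneg_of_ae ((h.nonneg_U 0).mono fun _ hω => pow_nonneg hω 3)
  have hbound := h.abs_integral_sub_integral_exp_le_of_abs_le hX ha hρ
    (h.integral_sub_sq_pos ha hρ) (h.sum_integral_idleTime_sq_le hp hpU) hd hB h₁ hL hm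
  have hmoments : errorConst p (moments P (U 0) 3) (moments P (S 0) 3)
      = ((∫ ω, U 0 ω ^ 2 ∂P + ∫ ω, S 0 ω ^ 2 ∂P) / 2
          + (2 * (∫ ω, U 0 ω ^ 3 ∂P + ∫ ω, S 0 ω ^ 3 ∂P)
            + 2 * (∫ ω, U 0 ω ^ 2 ∂P + ∫ ω, U 0 ω ^ 3 ∂P) / p * ∫ ω, U 0 ω ∂P)
          + ((∫ ω, U 0 ω ^ 2 ∂P + ∫ ω, S 0 ω ^ 2 ∂P) / (2 * ∫ ω, U 0 ω ∂P) * 2 + 1)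
            * ∫ ω, S 0 ω ^ 2 ∂P) / ∫ ω, U 0 ω ∂P := by
    simp [errorConst, moments, moment]
  rw [hmoments, ← mul_div_assoc, le_div_iff₀' ha]
  refine hbound.trans (mul_le_mul_of_nonneg_left ?_ (sub_nonneg.2 hρ.le))
  gcongr ?_ + ?_ + ?_
  · gcongr
  · refine (mul_le_of_le_one_left (by positivity) hload).trans ?_
    gcongr
  · gcongr

lemma abs_integral_truncate_sub_le (h : IsQueue P U S)
    (hX : TendstoInDistribution (scaledWorkload U S P) atTop X (fun _ : ℝ => P) P')
    (hρ : utilization U S P < 1) (hp : 0 < p)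
    (hpU : p ≤ P.real {ω | 2 * ∫ ω, S 0 ω ∂P + 3 < U 0 ω}) {f f' f'' : ℝ → ℝ}
    (h₁ : ∀ x, HasDerivAt f (f' x) x) (h₂ : ∀ x, HasDerivAt f' (f'' x) x)
    (hb₁ : ∀ x, |f' x| ≤ 1) (hb₂ : ∀ x, |f'' x| ≤ 1) (n : ℕ) :
    |∫ ω, truncate f n (X ω) ∂P' - ∫ y, truncate f n y ∂(expMeasure (expRate U S P))|
      ≤ (1 - utilization U S P) * errorConst p (moments P (U 0) 3) (moments P (S 0) 3) :=
  h.abs_integral_sub_le_errorConst_of_abs_le hX hρ hp hpU (hasDerivAt_truncate h₁ n)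
    (abs_truncate_le_const f n) (abs_truncateDeriv_le hb₁ n)
    (abs_truncateDeriv_sub_le h₁ h₂ hb₁ hb₂ n)
    (continuous_iff_continuousAt.2 fun x =>
      (hasDerivAt_truncateDeriv h₁ h₂ n x).continuousAt).measurable

lemma integrable_limit (h : IsQueue P U S)
    (hX : TendstoInDistribution (scaledWorkload U S P) atTop X (fun _ : ℝ => P) P')
    (hρ : utilization U S P < 1) (hp : 0 < p)
    (hpU : p ≤ P.real {ω | 2 * ∫ ω, S 0 ω ∂P + 3 < U 0 ω}) : Integrable X P' := by
  have hS : 0 ≤ ∫ ω, S 0 ω ∂P := integral_nonneg_of_ae (h.nonneg_S 0)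
  have hr := h.expRate_pos (h.integral_U_pos (by positivity) hp hpU) hρ
  have hX₀ : ∀ᵐ ω ∂P', 0 ≤ X ω := ae_nonneg_of_tendstoInDistribution hX fun _ _ =>
    mul_nonneg (sub_nonneg.2 hρ.le) (le_max_right _ _)
  have hint (n : ℕ) : Integrable (fun ω => truncate (fun x => x) n (X ω)) P' :=
    Integrable.of_bound ((continuous_truncate continuous_id n).measurable.comp_aemeasurable
      hX.aemeasurable_limit).aestronglyMeasurable _
      (Eventually.of_forall fun ω => abs_truncate_le_const _ n _)
  refine integrable_of_tendsto_of_integral_abs_le hint (fun ω => tendsto_truncate _ (X ω))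
    (D := ∫ y, |y| ∂(expMeasure (expRate U S P))
      + (1 - utilization U S P) * errorConst p (moments P (U 0) 3) (moments P (S 0) 3)) fun n => ?_
  have habs : ∫ ω, |truncate (fun x => x) n (X ω)| ∂P'
      = ∫ ω, truncate (fun x => x) n (X ω) ∂P' :=
    integral_congr_ae (hX₀.mono fun ω hω => abs_of_nonneg (truncate_nonneg hω))
  have hexp : ∫ y, truncate (fun x => x) n y ∂(expMeasure (expRate U S P))
      ≤ ∫ y, |y| ∂(expMeasure (expRate U S P)) :=
    (le_abs_self _).trans (abs_integral_le_integral_of_abs_le (abs_truncate_le _ n)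
      (integrable_id_expMeasure hr).abs)
  have hclose := h.abs_integral_truncate_sub_le hX hρ hp hpU (f := fun x => x) (f' := fun _ => 1)
    (f'' := fun _ => 0) hasDerivAt_id (fun x => hasDerivAt_const x 1) (by simp) (by simp) n
  rw [habs]
  linarith [(abs_le.1 hclose).2]

theorem abs_integral_sub_le_errorConst (h : IsQueue P U S)
    (hX : TendstoInDistribution (scaledWorkload U S P) atTop X (fun _ : ℝ => P) P')
    (hρ : utilization U S P < 1) (hp : 0 < p)
    (hpU : p ≤ P.real {ω | 2 * ∫ ω, S 0 ω ∂P + 3 < U 0 ω}) {f f' f'' : ℝ → ℝ}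
    (h₁ : ∀ x, HasDerivAt f (f' x) x) (h₂ : ∀ x, HasDerivAt f' (f'' x) x)
    (hb₁ : ∀ x, |f' x| ≤ 1) (hb₂ : ∀ x, |f'' x| ≤ 1) :
    |∫ ω, f (X ω) ∂P' - ∫ y, f y ∂(expMeasure (expRate U S P))|
      ≤ (1 - utilization U S P) * errorConst p (moments P (U 0) 3) (moments P (S 0) 3) := by
  have hS : 0 ≤ ∫ ω, S 0 ω ∂P := integral_nonneg_of_ae (h.nonneg_S 0)
  have hr := h.expRate_pos (h.integral_U_pos (by positivity) hp hpU) hρ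
  have := isProbabilityMeasure_expMeasure hr
  have hc : Continuous f := continuous_iff_continuousAt.2 fun x => (h₁ x).continuousAt
  have hfX := integrable_comp_of_abs_deriv_le (h.integrable_limit hX hρ hp hpU) h₁ hb₁
  have hfY := integrable_comp_of_abs_deriv_le (integrable_id_expMeasure hr) h₁ hb₁
  exact le_of_tendsto' ((tendsto_integral_truncate hc hX.aemeasurable_limit hfX).sub
    (tendsto_integral_truncate hc aemeasurable_id hfY)).abs
    fun n => h.abs_integral_truncate_sub_le hX hρ hp hpU h₁ h₂ hb₁ hb₂ n

theorem abs_integral_limit_sub_le_errorConst (h : IsQueue P U S)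
    (hX : TendstoInDistribution (scaledWorkload U S P) atTop X (fun _ : ℝ => P) P')
    (hρ : utilization U S P < 1) (hp : 0 < p)
    (hpU : p ≤ P.real {ω | 2 * ∫ ω, S 0 ω ∂P + 3 < U 0 ω}) :
    |∫ ω, X ω ∂P' - ∫ y, y ∂(expMeasure (expRate U S P))|
      ≤ (1 - utilization U S P) * errorConst p (moments P (U 0) 3) (moments P (S 0) 3) :=
  h.abs_integral_sub_le_errorConst hX hρ hp hpU (f := fun x => x) (f' := fun _ => 1)
    (f'' := fun _ => 0) hasDerivAt_id (fun x => hasDerivAt_const x 1) (by simp) (by simp)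

end IsQueue

lemma smoothClass_antitone : Antitone smoothClass := fun _ _ hkl _ hh =>
  ⟨fun j hj => hh.1 j (hj.trans_le hkl), fun j hj₁ hj => hh.2 j hj₁ (hj.trans hkl)⟩

lemma hasDerivAt_iteratedDeriv_of_mem_smoothClass {k j : ℕ} {f : ℝ → ℝ} (hf : f ∈ smoothClass k)
    (hj : j < k) (x : ℝ) : HasDerivAt (iteratedDeriv j f) (iteratedDeriv (j + 1) f x) x := by
  rw [iteratedDeriv_succ]
  exact (hf.1 j hj x).hasDerivAt

namespace Setting

variable {Ω Ω' : Type*} [MeasurableSpace Ω] [MeasurableSpace Ω']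
  {P : Measure Ω} [IsProbabilityMeasure P] {P' : Measure Ω'} [IsProbabilityMeasure P']
  {U S : ℕ → Ω → ℝ} {g : ℝ → ℝ} {X : Ω' → ℝ}

lemma exp_neg_le_measureReal (hs : Setting P P' U S g X) :
    Real.exp (-(hazardSup P (U 0) g * (2 * moments P (S 0) 3 0 + 3)))
      ≤ P.real {ω | 2 * ∫ ω, S 0 ω ∂P + 3 < U 0 ω} := by
  have h := hs.isQueue
  have hS : 0 ≤ ∫ ω, S 0 ω ∂P := integral_nonneg_of_ae (h.nonneg_S 0)
  simpa [moments, moment] using hs.isDensity.exp_neg_le_survival (h.measurable_U 0) (h.nonneg_U 0)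
    hs.bddAbove_hazardRate (by positivity : 0 ≤ 2 * ∫ ω, S 0 ω ∂P + 3)

lemma abs_integral_sub_le_of_mem_smoothClass (hs : Setting P P' U S g X) {f : ℝ → ℝ}
    (hf : f ∈ smoothClass 2) :
    |∫ ω, f (X ω) ∂P' - ∫ y, f y ∂(expMeasure (expRate U S P))|
      ≤ (1 - utilization U S P) *
        errorConst (Real.exp (-(hazardSup P (U 0) g * (2 * moments P (S 0) 3 0 + 3))))
          (moments P (U 0) 3) (moments P (S 0) 3) :=
  hs.isQueue.abs_integral_sub_le_errorConst hs.limit_law hs.utilization_lt_one (Real.exp_pos _)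
    hs.exp_neg_le_measureReal
    (by simpa using hasDerivAt_iteratedDeriv_of_mem_smoothClass hf zero_lt_two)
    (hasDerivAt_iteratedDeriv_of_mem_smoothClass hf one_lt_two)
    (hf.2 1 le_rfl one_le_two) (hf.2 2 one_le_two le_rfl)

end Setting

end GG1

theorem theorem2_general :
    ∃ C : ℝ × (Fin 3 → ℝ) × (Fin 3 → ℝ) → ℝ, ContinuousOn C {q | 0 < q.2.1 0} ∧
      ∀ (Ω Ω' : Type*) [MeasurableSpace Ω] [MeasurableSpace Ω']
        (P : Measure Ω) [IsProbabilityMeasure P] (P' : Measure Ω') [IsProbabilityMeasure P']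
        (U S : ℕ → Ω → ℝ) (g : ℝ → ℝ) (X : Ω' → ℝ),
        GG1.Setting P P' U S g X →
        (Integrable X P' ∧
          |∫ ω, X ω ∂P' - ∫ y, y ∂(expMeasure (GG1.expRate U S P))|
            ≤ (1 - GG1.utilization U S P) *
                C (GG1.hazardSup P (U 0) g, GG1.moments P (U 0) 3, GG1.moments P (S 0) 3)) ∧
        ∀ h ∈ GG1.smoothClass 2,
          |∫ ω, h (X ω) ∂P' - ∫ y, h y ∂(expMeasure (GG1.expRate U S P))|
            ≤ (1 - GG1.utilization U S P) *
                C (GG1.hazardSup P (U 0) g, GG1.moments P (U 0) 3, GG1.moments P (S 0) 3) := by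
  refine ⟨fun q => GG1.errorConst (Real.exp (-(q.1 * (2 * q.2.2 0 + 3)))) q.2.1 q.2.2, ?_, ?_⟩
  · exact GG1.continuousOn_errorConst (Continuous.continuousOn (by fun_prop))
      (Continuous.continuousOn (by fun_prop)) (Continuous.continuousOn (by fun_prop))
      (fun _ _ => Real.exp_pos _) fun _ hq => hq
  intro Ω Ω' _ _ P _ P' _ U S g X hs
  have h := hs.isQueue
  have hρ := hs.utilization_lt_one
  have hp := hs.exp_neg_le_measureReal
  exact ⟨⟨h.integrable_limit hs.limit_law hρ (Real.exp_pos _) hp,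
    h.abs_integral_limit_sub_le_errorConst hs.limit_law hρ (Real.exp_pos _) hp⟩,
    fun _ => hs.abs_integral_sub_le_of_mem_smoothClass⟩

theorem theorem2 :
    -- (a) nonincreasing hazard rate; the arguments of the constants stand for
    -- the supremum of the hazard rate, the moments of `U` and the moments of `S`
    (∃ (C₃ C₃' : ℝ × (Fin 3 → ℝ) × (Fin 3 → ℝ) → ℝ) (C₄' : ℝ × (Fin 3 → ℝ) × (Fin 4 → ℝ) → ℝ),
      ContinuousOn C₃ {p | 0 < p.1 ∧ (∀ i, 0 < p.2.1 i) ∧ ∀ i, 0 < p.2.2 i} ∧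
      ContinuousOn C₃' {p | 0 < p.1 ∧ (∀ i, 0 < p.2.1 i) ∧ ∀ i, 0 < p.2.2 i} ∧
      ContinuousOn C₄' {p | 0 < p.1 ∧ (∀ i, 0 < p.2.1 i) ∧ ∀ i, 0 < p.2.2 i} ∧
      ∀ (Ω Ω' : Type*) [MeasurableSpace Ω] [MeasurableSpace Ω']
        (P : Measure Ω) [IsProbabilityMeasure P] (P' : Measure Ω') [IsProbabilityMeasure P']
        (U S : ℕ → Ω → ℝ) (g : ℝ → ℝ) (X : Ω' → ℝ),
        GG1.Setting P P' U S g X →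
        AntitoneOn (GG1.hazardRate P (U 0) g) (Set.Ici 0) →
        (Integrable X P' ∧
          |∫ ω, X ω ∂P' - ∫ y, y ∂(expMeasure (GG1.expRate U S P))|
            ≤ (1 - GG1.utilization U S P) *
                C₃ (GG1.hazardSup P (U 0) g, GG1.moments P (U 0) 3, GG1.moments P (S 0) 3)) ∧
        (Integrable (fun ω => S 0 ω ^ 4) P → ∀ h ∈ GG1.smoothClass 3,
          |∫ ω, h (X ω) ∂P' - ∫ y, h y ∂(expMeasure (GG1.expRate U S P))|
            ≤ (1 - GG1.utilization U S P) *
                C₃' (GG1.hazardSup P (U 0) g, GG1.moments P (U 0) 3, GG1.moments P (S 0) 3)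
              + (1 - GG1.utilization U S P) ^ 2 *
                C₄' (GG1.hazardSup P (U 0) g, GG1.moments P (U 0) 3, GG1.moments P (S 0) 4))) ∧
    -- (b) hazard rate bounded below; the first two arguments of the constants stand for
    -- the supremum and the infimum of the hazard rate
    (∃ (C₃ C₃' : ℝ × ℝ × (Fin 3 → ℝ) × (Fin 3 → ℝ) → ℝ)
        (C₄' : ℝ × ℝ × (Fin 3 → ℝ) × (Fin 4 → ℝ) → ℝ),
      ContinuousOn C₃
        {p | 0 < p.1 ∧ 0 < p.2.1 ∧ (∀ i, 0 < p.2.2.1 i) ∧ ∀ i, 0 < p.2.2.2 i} ∧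
      ContinuousOn C₃'
        {p | 0 < p.1 ∧ 0 < p.2.1 ∧ (∀ i, 0 < p.2.2.1 i) ∧ ∀ i, 0 < p.2.2.2 i} ∧
      ContinuousOn C₄'
        {p | 0 < p.1 ∧ 0 < p.2.1 ∧ (∀ i, 0 < p.2.2.1 i) ∧ ∀ i, 0 < p.2.2.2 i} ∧
      ∀ (Ω Ω' : Type*) [MeasurableSpace Ω] [MeasurableSpace Ω']
        (P : Measure Ω) [IsProbabilityMeasure P] (P' : Measure Ω') [IsProbabilityMeasure P']
        (U S : ℕ → Ω → ℝ) (g : ℝ → ℝ) (X : Ω' → ℝ),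
        GG1.Setting P P' U S g X →
        0 < GG1.hazardInf P (U 0) g →
        (Integrable X P' ∧
          |∫ ω, X ω ∂P' - ∫ y, y ∂(expMeasure (GG1.expRate U S P))|
            ≤ (1 - GG1.utilization U S P) *
                C₃ (GG1.hazardSup P (U 0) g, GG1.hazardInf P (U 0) g,
                  GG1.moments P (U 0) 3, GG1.moments P (S 0) 3)) ∧
        (Integrable (fun ω => S 0 ω ^ 4) P → ∀ h ∈ GG1.smoothClass 3,
          |∫ ω, h (X ω) ∂P' - ∫ y, h y ∂(expMeasure (GG1.expRate U S P))|
            ≤ (1 - GG1.utilization U S P) *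
                C₃' (GG1.hazardSup P (U 0) g, GG1.hazardInf P (U 0) g,
                  GG1.moments P (U 0) 3, GG1.moments P (S 0) 3)
              + (1 - GG1.utilization U S P) ^ 2 *
                C₄' (GG1.hazardSup P (U 0) g, GG1.hazardInf P (U 0) g,
                  GG1.moments P (U 0) 3, GG1.moments P (S 0) 4))) := by
  obtain ⟨C, hC, hbound⟩ := theorem2_general
  obtain ⟨D, hD, hbound'⟩ := theorem2_general
  refine ⟨⟨C, C, fun _ => 0, hC.mono fun q hq => hq.2.1 0, hC.mono fun q hq => hq.2.1 0,
    continuousOn_const, fun Ω Ω' _ _ P _ P' _ U S g X hs _ => ?_⟩,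
    ⟨fun q => D (q.1, q.2.2), fun q => D (q.1, q.2.2), fun _ => 0,
    hD.comp (by fun_prop) fun q hq => hq.2.2.1 0, hD.comp (by fun_prop) fun q hq => hq.2.2.1 0,
    continuousOn_const, fun Ω Ω' _ _ P _ P' _ U S g X hs _ => ?_⟩⟩ <;>
    simp only [mul_zero, add_zero]
  · obtain ⟨hmean, hsmooth⟩ := hbound Ω Ω' P P' U S g X hs
    exact ⟨hmean, fun _ h hh => hsmooth h (GG1.smoothClass_antitone (by norm_num) hh)⟩
  · obtain ⟨hmean, hsmooth⟩ := hbound' Ω Ω' P P' U S g X hs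
    exact ⟨hmean, fun _ h hh => hsmooth h (GG1.smoothClass_antitone (by norm_num) hh)⟩
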